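/- An approval profile consists of a finite set $\mathcal{A}$ of alternatives, a finite set $\mathcal{V}$ of voters, and an approval set $V_i\subseteq\mathcal{A}$ for every voter $v_i\in\mathcal{V}$. It is single-peaked if there is a linear order of $\mathcal{A}$ in which every approval set $V_i$ is an interval, and single-crossing if there is a linear order of $\mathcal{V}$ in which, for every alternative $a$, the set of voters that approve of $a$ is an interval. (Empty intervals are allowed.) In the problem MAV-MW one is given an approval profile, a committee size $k\in\mathbb{N}$ and a bound $R\in\mathbb{N}$, and asks whether there is a set $W\subseteq\mathcal{A}$ with $|W|=k$ such that $$\max_{v_i\in\mathcal{V}}\bigl(|V_i\setminus W|+|W\setminus V_i|\bigr)\le R .$$ Proposition. (1) MAV-MW is fixed-parameter tractable for profiles that become single-peaked after deleting $t_a$ alternatives, parameterized by $t_a$, where a set of $t_a$ alternatives whose deletion makes the profile single-peaked is given with the input. More precisely, there are a constant $c$ and an algorithm that, given a profile, numbers $k,R\in\mathbb{N}$ and a set $D$ of $t_a$ alternatives such that deleting the alternatives in $D$ from the profile leaves a single-peaked profile, decides whether $(\text{profile},k,R)$ is a yes-instance of MAV-MW in at most $2^{t_a}\cdot|I|^{c}$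 steps, where $|I|$ is the length of the input. (The linear order is not part of the input.) (2) The same holds with "single-crossing" in place of "single-peaked". The model of computation is a random access machine on natural numbers that adds, subtracts (truncated at $0$), loads constants, moves numbers between registers and array cells with indirect addressing, and tests for $0$, at unit cost, without multiplication. The input consists of the numbers of alternatives and voters, $k$, $R$, the 0/1-matrix of the profile and the 0/1-vector of $D$; its length is the total number of bits of these numbers in binary, with one separator per number. -/

import Mathlib

/-! ## Approval profiles and the minimax approval voting rule -/

/-- An approval profile with alternatives `A` and voters `V`: every voter has an approval set. -/
abbrev ApprovalProfile (A V : Type) : Type := V → Finset A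

namespace ApprovalProfile

variable {A V : Type}

/-- `P` is single-peaked: for some linear order of the alternatives, the approval set of every
voter is an interval (possibly empty) of that order. -/
def SinglePeaked (P : ApprovalProfile A V) : Prop :=
  ∃ _ : LinearOrder A, ∀ v : V, Set.OrdConnected {a : A | a ∈ P v}

/-- `P` is single-crossing: for some linear order of the voters, the set of voters that approve of
an alternative is, for every alternative, an interval (possibly empty) of that order. -/
def SingleCrossing (P : ApprovalProfile A V) : Prop :=
  ∃ _ : LinearOrder V, ∀ a : A, Set.OrdConnected {v : V | a ∈ P v}

/-- The profile that results from `P` by deleting the alternatives in `D`. -/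
def deleteAlternatives [DecidableEq A] (P : ApprovalProfile A V) (D : Finset A) :
    ApprovalProfile {a : A // a ∉ D} V :=
  fun v => (P v).subtype (fun a => a ∉ D)

/-- The misrepresentation of a committee `W`: the largest Hamming distance between `W` and an
approval set. -/
def misrepresentation [DecidableEq A] [Fintype V] (P : ApprovalProfile A V) (W : Finset A) : ℕ :=
  Finset.univ.sup fun v : V => (P v \ W).card + (W \ P v).card

end ApprovalProfile

/-- An instance of the winner determination problem for minimax approval voting, together with a
set of alternatives to be deleted. -/
structure MAVInstance where
  /-- number of alternatives -/
  m : ℕ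
  /-- number of voters -/
  n : ℕ
  /-- the approval sets -/
  profile : ApprovalProfile (Fin m) (Fin n)
  /-- committee size -/
  k : ℕ
  /-- misrepresentation bound -/
  R : ℕ
  /-- the alternatives to be deleted -/
  deleted : Finset (Fin m)

namespace MAVInstance

/-- The yes-instances: some committee of size `k` has misrepresentation at most `R`. -/
def IsYes (I : MAVInstance) : Prop :=
  ∃ W : Finset (Fin I.m), W.card = I.k ∧ I.profile.misrepresentation W ≤ I.R

/-- The encoding of an instance as a list of numbers: the numbers `m, n, k, R`, the 0/1-matrix of
the profile (one row per voter), and the 0/1-vector of the set of alternatives to be deleted. -/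
def encode (I : MAVInstance) : List ℕ :=
  [I.m, I.n, I.k, I.R]
    ++ (List.ofFn fun v : Fin I.n =>
          List.ofFn fun a : Fin I.m => if a ∈ I.profile v then 1 else 0).flatten
    ++ List.ofFn fun a : Fin I.m => if a ∈ I.deleted then 1 else 0

end MAVInstance

/-! ## Random access machines with unit cost

The machine has registers and arrays of natural numbers. An elementary instruction adds, subtracts
(truncated at 0), sets a register to a constant, or moves a number between a register and an
array cell whose index is in a register; every elementary instruction and every test of a register
for 0 takes one step. There is no multiplication, so the bit length of the numbers grows by
at most a constant per step and the step count is polynomially related to Turing machine time. -/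

namespace RAM

structure State where
  reg : ℕ → ℕ
  arr : ℕ → ℕ → ℕ

inductive Instr where
  /-- `const r c`: register `r` becomes `c` -/
  | const (r c : ℕ)
  /-- `add r x y`: register `r` becomes the sum of registers `x` and `y` -/
  | add (r x y : ℕ)
  /-- `sub r x y`: register `r` becomes the truncated difference of registers `x` and `y` -/
  | sub (r x y : ℕ)
  /-- `load r b i`: register `r` becomes the cell of array `b` whose index is in register `i` -/
  | load (r b i : ℕ)
  /-- `store b i r`: the cell of array `b` whose index is in register `i` becomes register `r` -/
  | store (b i r : ℕ)

/-- The effect of an elementary instruction. -/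
def Instr.apply : Instr → State → State
  | const r c, s => { s with reg := Function.update s.reg r c }
  | add r x y, s => { s with reg := Function.update s.reg r (s.reg x + s.reg y) }
  | sub r x y, s => { s with reg := Function.update s.reg r (s.reg x - s.reg y) }
  | load r b i, s => { s with reg := Function.update s.reg r (s.arr b (s.reg i)) }
  | store b i r, s =>
      { s with arr := Function.update s.arr b (Function.update (s.arr b) (s.reg i) (s.reg r)) }

inductive Program where
  | instr (i : Instr)
  | seq (p q : Program)
  /-- if register `r` is not 0 then `p` else `q` -/
  | cond (r : ℕ) (p q : Program)
  /-- while register `r` is not 0 do `p` -/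
  | loop (r : ℕ) (p : Program)

/-- `Exec p s s' t`: started in state `s`, the program `p` halts in state `s'` after exactly
`t` steps. -/
inductive Exec : Program → State → State → ℕ → Prop where
  | instr (i : Instr) (s : State) : Exec (.instr i) s (i.apply s) 1
  | seq {p q : Program} {s s' s'' : State} {t t' : ℕ} :
      Exec p s s' t → Exec q s' s'' t' → Exec (.seq p q) s s'' (t + t')
  | condTrue {r : ℕ} {p q : Program} {s s' : State} {t : ℕ} :
      s.reg r ≠ 0 → Exec p s s' t → Exec (.cond r p q) s s' (t + 1)
  | condFalse {r : ℕ} {p q : Program} {s s' : State} {t : ℕ} :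
      s.reg r = 0 → Exec q s s' t → Exec (.cond r p q) s s' (t + 1)
  | loopTrue {r : ℕ} {p : Program} {s s' s'' : State} {t t' : ℕ} :
      s.reg r ≠ 0 → Exec p s s' t → Exec (.loop r p) s' s'' t' →
        Exec (.loop r p) s s'' (t + t' + 1)
  | loopFalse {r : ℕ} {p : Program} {s : State} :
      s.reg r = 0 → Exec (.loop r p) s s 1

/-- The initial state on input `x`: array 0 holds `x`, everything else is 0. -/
def initial (x : List ℕ) : State where
  reg := fun _ => 0
  arr := fun b i => if b = 0 then x.getD i 0 else 0

/-- On input `x`, the program halts within `T` steps, and its answer (in register 0)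
is 1 if and only if `yes` holds. -/
def DecidesWithin (p : Program) (x : List ℕ) (yes : Prop) (T : ℕ) : Prop :=
  ∃ (s : State) (t : ℕ), Exec p (initial x) s t ∧ t ≤ T ∧ (s.reg 0 = 1 ↔ yes)

/-- The length of an input, where each number is written in binary and followed by a separator. -/
def inputLength (x : List ℕ) : ℕ :=
  (x.map fun a => a.size + 1).sum

end RAM

/-- The decision problem `yes`, restricted to the instances that satisfy `promise` and
parameterized by `κ`, is fixed-parameter tractable with running time `f(κ) * |x| ^ O(1)`:
a single program decides it within that time. -/
def FPTInTime {ι : Type} (f : ℕ → ℕ) (encode : ι → List ℕ) (promise yes : ι → Prop)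
    (κ : ι → ℕ) : Prop :=
  ∃ (p : RAM.Program) (c : ℕ), ∀ I : ι, promise I →
    RAM.DecidesWithin p (encode I) (yes I) (f (κ I) * RAM.inputLength (encode I) ^ c)

/-!
One program decides both problems. It tries every set `S` of deleted alternatives as the deleted
part of the committee `W`. Since the Hamming distance between `W` and an approval set `P` is
`|P| + k - 2 |P ∩ W|`, what remains is a covering problem: choose at most `k - |S|` of the other
alternatives such that every voter approves of sufficiently many of them
(`MAVInstance.isYes_iff`).

The covering problem is solved by a greedy algorithm that does not need the linear order. Call a
voter active if the demand of the voter is not yet met. The algorithm looks for an active voter `v`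
and an available alternative `p` approved by `v` such that every active voter who approves of any
available alternative of `v` approves of `p`. Choosing `p` is safe: a solution contains an
alternative approved by `v`, and this alternative can be exchanged for `p`
(`MAVInstance.completable_choose`). As long as some active voter approves of an available
alternative, such a pair exists, both for single-peaked profiles (take the voter whose last
available alternative comes first) and for single-crossing ones (take the first active voter and
the alternative that reaches furthest); see `ApprovalProfile.SinglePeaked.hasDominant` and
`ApprovalProfile.SingleCrossing.hasDominant`. So the algorithm stops with a solution if there is one
(`MAVInstance.success_greedy_iff`).

On the machine, the sets `S` are enumerated through the numbers below `2 ^ t`, whose bits are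
extracted by doubling. Programs are verified by means of `RAM.Within`, a total correctness
predicate in which the time bound is not explicit but is `RAM.Program.cost`, a function of the
program and of a common bound `B` for the number of rounds of its loops. By
`RAM.Program.cost_le` it is polynomial in `B`.
-/

/-! ### Reasoning about programs -/

namespace RAM

/-- The state `s` with register `r` set to `x`. -/
abbrev State.setReg (s : State) (r x : ℕ) : State :=
  { s with reg := Function.update s.reg r x }

/-- Whether register `x` is the target of the instruction. -/
def Instr.writesReg : Instr → ℕ → Bool
  | const r _, x => x == r
  | add r _ _, x => x == r
  | sub r _ _, x => x == r
  | load r _ _, x => x == r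
  | store _ _ _, _ => false

/-- Whether array `x` is the target of the instruction. -/
def Instr.writesArr : Instr → ℕ → Bool
  | store b _ _, x => x == b
  | _, _ => false

namespace Program

/-- Whether the program contains an instruction that writes register `x`. -/
def writesReg : Program → ℕ → Bool
  | instr i, x => i.writesReg x
  | seq p q, x => p.writesReg x || q.writesReg x
  | cond _ p q, x => p.writesReg x || q.writesReg x
  | loop _ p, x => p.writesReg x

/-- Whether the program contains an instruction that writes array `x`. -/
def writesArr : Program → ℕ → Bool
  | instr i, x => i.writesArr x
  | seq p q, x => p.writesArr x || q.writesArr x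
  | cond _ p q, x => p.writesArr x || q.writesArr x
  | loop _ p, x => p.writesArr x

/-- The number of nodes of the syntax tree. -/
def size : Program → ℕ
  | instr _ => 1
  | seq p q => p.size + q.size
  | cond _ p q => p.size + q.size + 1
  | loop _ p => p.size + 1

/-- A bound on the number of steps under the assumption that every loop runs its body at most
`B` times. -/
def cost (B : ℕ) : Program → ℕ
  | instr _ => 1
  | seq p q => p.cost B + q.cost B
  | cond _ p q => p.cost B + q.cost B + 1
  | loop _ p => B * (p.cost B + 1) + 1

theorem size_pos (p : Program) : 1 ≤ p.size := by
  induction p <;> simp only [size] <;> omega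

/-- The cost is polynomial in `B`: the exponent depends on the program only. -/
theorem cost_le (B : ℕ) (p : Program) : p.cost B ≤ (B + 2) ^ p.size := by
  have hpow : ∀ q : Program, B + 2 ≤ (B + 2) ^ q.size := fun q =>
    Nat.le_self_pow (by have := q.size_pos; omega) _
  induction p with
  | instr i => simp [cost, size]
  | seq p q hp hq =>
    have := hpow p; have := hpow q
    simp only [cost, size, pow_add]; nlinarith
  | cond r p q hp hq =>
    have := hpow p; have := hpow q
    simp only [cost, size, pow_add, pow_one]
    have h : (B + 2) ^ p.size + (B + 2) ^ q.size ≤ (B + 2) ^ p.size * (B + 2) ^ q.size := by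
      nlinarith
    nlinarith
  | loop r p hp =>
    have := hpow p
    simp only [cost, size, pow_succ]
    nlinarith

/-- A program without effect on the registers other than 2 and on the arrays. -/
def skip : Program := instr (.const 2 0)

/-- The program that runs `body` for the values `N - 1, …, 1, 0` of register `i`, where `N` is the
content of register `n`. Register 2 holds the constants that are needed for this. -/
def forLoop (i n : ℕ) (body : Program) : Program :=
  seq (instr (.const 2 0)) (seq (instr (.add i n 2))
    (loop i (seq (instr (.const 2 1)) (seq (instr (.sub i i 2)) body))))

end Program

/-- The states agree on everything that `p` does not write. -/
structure Frame (p : Program) (s s' : State) : Prop where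
  reg : ∀ r, p.writesReg r = false → s'.reg r = s.reg r
  arr : ∀ b, p.writesArr b = false → s'.arr b = s.arr b

theorem Frame.refl (p : Program) (s : State) : Frame p s s := ⟨fun _ _ => rfl, fun _ _ => rfl⟩

theorem Frame.trans {p : Program} {s s' s'' : State} (h : Frame p s s') (h' : Frame p s' s'') :
    Frame p s s'' :=
  ⟨fun r hr => (h'.reg r hr).trans (h.reg r hr), fun b hb => (h'.arr b hb).trans (h.arr b hb)⟩

theorem Frame.weaken {p q : Program} {s s' : State} (h : Frame p s s')
    (hr : ∀ r, q.writesReg r = false → p.writesReg r = false)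
    (ha : ∀ b, q.writesArr b = false → p.writesArr b = false) : Frame q s s' :=
  ⟨fun r h' => h.reg r (hr r h'), fun b h' => h.arr b (ha b h')⟩

theorem Frame.setReg {p : Program} {s s' : State} (h : Frame p s s') {r : ℕ} (x : ℕ)
    (hr : p.writesReg r = true) : Frame p s (s'.setReg r x) := by
  refine ⟨fun q hq => ?_, h.arr⟩
  have : q ≠ r := by rintro rfl; simp [hr] at hq
  simpa [State.setReg, this] using h.reg q hq

theorem Instr.frame (i : Instr) (s : State) : Frame (.instr i) s (i.apply s) := by
  cases i <;> constructor <;> intro x hx <;>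
    simp_all [Program.writesReg, Program.writesArr, Instr.writesReg, Instr.writesArr, Instr.apply]

theorem Exec.frame {p : Program} {s s' : State} {t : ℕ} (h : Exec p s s' t) : Frame p s s' := by
  induction h with
  | instr i s => exact i.frame s
  | seq _ _ h₁ h₂ =>
    exact (h₁.weaken (by simp +contextual [Program.writesReg])
      (by simp +contextual [Program.writesArr])).trans
      (h₂.weaken (by simp +contextual [Program.writesReg])
      (by simp +contextual [Program.writesArr]))
  | condTrue _ _ h | condFalse _ _ h =>
    exact h.weaken (by simp +contextual [Program.writesReg])
      (by simp +contextual [Program.writesArr])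
  | loopTrue _ _ _ h₁ h₂ =>
    exact (h₁.weaken (by simp [Program.writesReg]) (by simp [Program.writesArr])).trans h₂
  | loopFalse _ => exact Frame.refl _ _

/-- Started in state `s`, the program `p` halts in a state that satisfies `Q`, within `F` times
the cost of `p` for loops with at most `B` rounds. -/
def Within (F B : ℕ) (p : Program) (Q : State → Prop) (s : State) : Prop :=
  ∃ (s' : State) (t : ℕ), Exec p s s' t ∧ t ≤ F * p.cost B ∧ Q s'

section Within

variable {F B : ℕ} {p q : Program} {Q Q' : State → Prop} {s : State}

/-- What the program does not write may be assumed to be unchanged afterwards. -/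
theorem Within.imp (h : Within F B p Q s) (hQ : ∀ s', Frame p s s' → Q s' → Q' s') :
    Within F B p Q' s := by
  obtain ⟨s', t, he, ht, hq⟩ := h
  exact ⟨s', t, he, ht, hQ s' he.frame hq⟩

theorem Within.mono_factor (h : Within 1 B p Q s) (hF : 1 ≤ F) : Within F B p Q s := by
  obtain ⟨s', t, he, ht, hq⟩ := h
  exact ⟨s', t, he, ht.trans (Nat.mul_le_mul_right _ hF), hq⟩

theorem within_instr (i : Instr) (hF : 1 ≤ F) (h : Q (i.apply s)) :
    Within F B (.instr i) Q s :=
  ⟨_, 1, .instr i s, by simpa [Program.cost] using hF, h⟩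

theorem within_seq (h : Within F B p (Within F B q Q) s) : Within F B (.seq p q) Q s := by
  obtain ⟨s', t, he, ht, s'', t', he', ht', hq⟩ := h
  exact ⟨s'', t + t', .seq he he', by simp only [Program.cost, mul_add]; omega, hq⟩

theorem within_cond {r : ℕ} (hF : 1 ≤ F) (h₁ : s.reg r ≠ 0 → Within F B p Q s)
    (h₂ : s.reg r = 0 → Within F B q Q s) : Within F B (.cond r p q) Q s := by
  by_cases hr : s.reg r = 0
  · obtain ⟨s', t, he, ht, hq⟩ := h₂ hr
    exact ⟨s', t + 1, .condFalse hr he, by simp only [Program.cost, mul_add, mul_one]; omega, hq⟩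
  · obtain ⟨s', t, he, ht, hq⟩ := h₁ hr
    exact ⟨s', t + 1, .condTrue hr he, by simp only [Program.cost, mul_add, mul_one]; omega, hq⟩

theorem within_skip (hF : 1 ≤ F) (h : Q (s.setReg 2 0)) : Within F B .skip Q s :=
  within_instr _ hF h

/-- The rule for loops with a factor `G`, which allows `G * B` rounds at the price of multiplying
the time by `G`. In the invariant `Inv j`, the rounds for the values below `j` are still to come. -/
theorem within_forLoop_of_invariant {i n N G : ℕ} {body : Program} {s₀ : State}
    (Inv : ℕ → State → Prop)
    (hN : s₀.reg n = N) (hG : 1 ≤ G) (hNB : N ≤ G * B) (hi : body.writesReg i = false)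
    (hi2 : i ≠ 2) (hn2 : n ≠ 2)
    (hInv : ∀ j s r x, r = 2 ∨ r = i → Inv j s → Inv j (s.setReg r x))
    (h₀ : Inv N s₀)
    (hbody : ∀ j < N, ∀ s, Frame (.forLoop i n body) s₀ s → s.reg i = j → Inv (j + 1) s →
      Within 1 B body (Inv j) s) :
    Within G B (.forLoop i n body) (Inv 0) s₀ := by
  have key : ∀ j ≤ N, ∀ s, Frame (.forLoop i n body) s₀ s → s.reg i = j → Inv j s →
      ∃ s' t, Exec (.loop i (.seq (.instr (.const 2 1)) (.seq (.instr (.sub i i 2)) body))) s s' t ∧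
        t ≤ j * (body.cost B + 3) + 1 ∧ Inv 0 s' := by
    intro j
    induction j with
    | zero =>
      intro _ s _ hs hI
      exact ⟨s, 1, .loopFalse hs, by simp, hI⟩
    | succ j ih =>
      intro hj s hF hs hI
      have hw2 : Program.writesReg (.forLoop i n body) 2 = true := by
        simp [Program.forLoop, Program.writesReg, Instr.writesReg]
      have hwi : Program.writesReg (.forLoop i n body) i = true := by
        simp [Program.forLoop, Program.writesReg, Instr.writesReg]
      obtain ⟨s', t, he, ht, hI'⟩ := hbody j (by omega) ((s.setReg 2 1).setReg i j)
        ((hF.setReg 1 hw2).setReg j hwi) (by simp)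
        (hInv _ _ _ _ (.inr rfl) (hInv _ _ _ _ (.inl rfl) hI))
      have hF' : Frame (.forLoop i n body) s₀ s' :=
        ((hF.setReg 1 hw2).setReg j hwi).trans (he.frame.weaken
          (fun r hr => by simp_all [Program.forLoop, Program.writesReg])
          (fun r hr => by simp_all [Program.forLoop, Program.writesArr]))
      obtain ⟨s'', t', he', ht', hI''⟩ := ih (by omega) s' hF'
        (by rw [he.frame.reg i hi]; simp) hI'
      have hstep : (Instr.sub i i 2).apply ((Instr.const 2 1).apply s)
          = (s.setReg 2 1).setReg i j := by
        simp [Instr.apply, hs, hi2]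
      refine ⟨s'', _, .loopTrue (by omega) (.seq (.instr _ s) (.seq (.instr _ _) (hstep ▸ he))) he',
        ?_, hI''⟩
      · have : (j + 1) * (body.cost B + 3) = j * (body.cost B + 3) + (body.cost B + 3) := by ring
        omega
  have hinit : (Instr.add i n 2).apply ((Instr.const 2 0).apply s₀)
      = (s₀.setReg 2 0).setReg i N := by
    simp [Instr.apply, hN, hn2]
  obtain ⟨s', t, he, ht, hI⟩ := key N le_rfl ((s₀.setReg 2 0).setReg i N)
    (((Frame.refl _ _).setReg 0 (by simp [Program.forLoop, Program.writesReg,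
      Instr.writesReg])).setReg N (by simp [Program.forLoop, Program.writesReg, Instr.writesReg]))
    (by simp) (hInv _ _ _ _ (.inr rfl) (hInv _ _ _ _ (.inl rfl) h₀))
  refine ⟨s', _, .seq (.instr _ s₀) (.seq (.instr _ _) (hinit ▸ he)), ?_, hI⟩
  simp only [Program.forLoop, Program.cost]
  nlinarith [Nat.mul_le_mul_right (body.cost B + 3) hNB]

end Within

/-- The result of applying `f (N - 1)`, …, `f 1`, `f 0` to `a`, in this order. -/
def iterDown {α : Type*} (f : ℕ → α → α) : ℕ → α → α
  | 0, a => a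
  | j + 1, a => iterDown f j (f j a)

/-- If the body of a loop acts on a component `abs` of the state as the function `f`, then the
loop acts on it as the iterated function. -/
theorem within_forLoop {α : Type*} {B : ℕ} {i n N G : ℕ} {body : Program} {s₀ : State}
    (abs : State → α) (f : ℕ → α → α)
    (hN : s₀.reg n = N) (hG : 1 ≤ G) (hNB : N ≤ G * B) (hi : body.writesReg i = false)
    (hi2 : i ≠ 2) (hn2 : n ≠ 2)
    (habs : ∀ s r x, r = 2 ∨ r = i → abs (s.setReg r x) = abs s)
    (hbody : ∀ j < N, ∀ s, Frame (.forLoop i n body) s₀ s → s.reg i = j →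
      Within 1 B body (fun s' => abs s' = f j (abs s)) s) :
    Within G B (.forLoop i n body) (fun s' => abs s' = iterDown f N (abs s₀)) s₀ :=
  within_forLoop_of_invariant (fun j s => iterDown f j (abs s) = iterDown f N (abs s₀))
    hN hG hNB hi hi2 hn2 (fun j s r x hr h => by rw [habs s r x hr, h]) rfl
    (fun j hj s hF hs hI => (hbody j hj s hF hs).imp fun s' _ h => by
      rw [h]; exact hI)

theorem iterDown_update (g : ℕ → ℕ → ℕ) (N : ℕ) (e : ℕ → ℕ) :
    iterDown (fun v e => Function.update e v (g v (e v))) N e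
      = fun v => if v < N then g v (e v) else e v := by
  induction N generalizing e with
  | zero => simp [iterDown]
  | succ N ih =>
    rw [iterDown, ih]
    funext v
    rcases lt_trichotomy v N with h | rfl | h
    · simp [h, h.ne, show v < N + 1 by omega]
    · simp
    · simp [h.ne', show ¬ v < N by omega, show ¬ v < N + 1 by omega]

theorem iterDown_add (g : ℕ → ℕ) (N x : ℕ) :
    iterDown (fun a x => x + g a) N x = x + ∑ a ∈ Finset.range N, g a := by
  induction N generalizing x with
  | zero => simp [iterDown]
  | succ N ih => rw [iterDown, ih, Finset.sum_range_succ]; ring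

/-! ### Formulas with bounded quantifiers -/

/-- Formulas about the cells of the arrays, whose variables are registers. -/
inductive Formula where
  /-- the cell of array `b` with index `x` is not 0 -/
  | cell (b x : ℕ)
  /-- the entry in column `y` of the row `x` of a matrix is not 0, where the matrix is in array 0
  and the addresses at which its rows start are in array 1 -/
  | entry (x y : ℕ)
  | not (φ : Formula)
  | and (φ ψ : Formula)
  /-- for some value of the variable `i` below register `n` -/
  | ex (i n : ℕ) (φ : Formula)

namespace Formula

/-- The formula is true in the state `s`. -/
def Holds : Formula → State → Prop
  | cell b x, s => s.arr b (s.reg x) ≠ 0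
  | entry x y, s => s.arr 0 (s.arr 1 (s.reg x) + s.reg y) ≠ 0
  | not φ, s => ¬ φ.Holds s
  | and φ ψ, s => φ.Holds s ∧ ψ.Holds s
  | ex i n φ, s => ∃ j < s.reg n, φ.Holds (s.setReg i j)

/-- The free variables. -/
def free : Formula → List ℕ
  | cell _ x => [x]
  | entry x y => [x, y]
  | not φ => φ.free
  | and φ ψ => φ.free ++ ψ.free
  | ex i n φ => n :: φ.free.filter (· ≠ i)

/-- The registers that bound the quantifiers. -/
def bounds : Formula → List ℕ
  | cell _ _ => []
  | entry _ _ => []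
  | not φ => φ.bounds
  | and φ ψ => φ.bounds ++ ψ.bounds
  | ex _ n φ => n :: φ.bounds

/-- The program that evaluates a formula: it makes register 1 nonzero if and only if the formula
holds. Besides, it changes only register 2 and the registers of the bound variables. -/
def eval : Formula → Program
  | cell b x => .instr (.load 1 b x)
  | entry x y => .seq (.instr (.load 1 1 x)) (.seq (.instr (.add 1 1 y)) (.instr (.load 1 0 1)))
  | not φ => .seq φ.eval (.seq (.instr (.const 2 1)) (.instr (.sub 1 2 1)))
  | and φ ψ => .seq φ.eval (.cond 1 ψ.eval .skip)
  | ex i n φ => .seq (.instr (.const 1 0)) (.forLoop i n (.cond 1 .skip φ.eval))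

/-- No variable is overwritten while it is still needed. -/
def WellFormed : Formula → Prop
  | cell _ _ => True
  | entry _ y => y ≠ 1
  | not φ => φ.WellFormed
  | and φ ψ => φ.WellFormed ∧ ψ.WellFormed ∧ ∀ r ∈ ψ.free ++ ψ.bounds, φ.eval.writesReg r = false
  | ex i n φ => φ.WellFormed ∧ i ≠ 1 ∧ i ≠ 2 ∧ n ≠ 1 ∧ n ≠ 2 ∧ n ≠ i ∧
      1 ∉ φ.free ∧ 2 ∉ φ.free ∧ φ.eval.writesReg i = false ∧
      (∀ r ∈ φ.bounds, r ≠ 1 ∧ r ≠ 2 ∧ r ≠ i ∧ φ.eval.writesReg r = false) ∧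
      ∀ r ∈ φ.free, φ.eval.writesReg r = false

instance decidableWellFormed : (φ : Formula) → Decidable φ.WellFormed
  | cell _ _ => inferInstanceAs (Decidable True)
  | entry _ y => inferInstanceAs (Decidable (y ≠ 1))
  | not φ => decidableWellFormed φ
  | and φ ψ =>
    have := decidableWellFormed φ
    have := decidableWellFormed ψ
    inferInstanceAs (Decidable (_ ∧ _ ∧ _))
  | ex _ _ φ =>
    have := decidableWellFormed φ
    inferInstanceAs (Decidable (_ ∧ _))

theorem eval_writesArr (φ : Formula) (b : ℕ) : φ.eval.writesArr b = false := by
  induction φ <;>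
    simp_all [eval, Program.writesArr, Instr.writesArr, Program.skip, Program.forLoop]

theorem holds_congr {φ : Formula} {s s' : State} (harr : s'.arr = s.arr)
    (hreg : ∀ r ∈ φ.free, s'.reg r = s.reg r) : φ.Holds s' ↔ φ.Holds s := by
  induction φ generalizing s s' with
  | cell b x => simp [Holds, harr, hreg x (by simp [free])]
  | entry x y => simp [Holds, harr, hreg x (by simp [free]), hreg y (by simp [free])]
  | not φ ih => simp only [Holds]; rw [ih harr hreg]
  | and φ ψ ih₁ ih₂ =>
    simp only [free, List.mem_append] at hreg
    simp only [Holds]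
    rw [ih₁ harr fun r hr => hreg r (.inl hr), ih₂ harr fun r hr => hreg r (.inr hr)]
  | ex i n φ ih =>
    simp only [free, List.mem_cons, List.mem_filter] at hreg
    simp only [Holds]
    rw [hreg n (.inl rfl)]
    refine exists_congr fun j => and_congr_right fun _ => ih harr fun r hr => ?_
    by_cases hri : r = i
    · simp [hri]
    · simpa [hri] using hreg r (.inr ⟨hr, by simpa using hri⟩)

theorem within_eval {B : ℕ} {φ : Formula} (hφ : φ.WellFormed) {s : State}
    (hB : ∀ r ∈ φ.bounds, s.reg r ≤ B) :
    Within 1 B φ.eval (fun s' => s'.reg 1 ≠ 0 ↔ φ.Holds s) s := by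
  induction φ generalizing s with
  | cell b x => exact within_instr _ le_rfl (by simp [Instr.apply, Holds])
  | entry x y =>
    have hy : y ≠ 1 := hφ
    exact within_seq (within_instr _ le_rfl (within_seq (within_instr _ le_rfl
      (within_instr _ le_rfl (by simp [Instr.apply, Holds, hy])))))
  | not φ ih =>
    refine within_seq ((ih hφ hB).imp fun s' _ h => within_seq (within_instr _ le_rfl
      (within_instr _ le_rfl ?_)))
    simp only [Instr.apply, Holds, ← h]
    simp only [Function.update_self, ne_eq, OfNat.one_ne_ofNat, not_false_eq_true,
      Function.update_of_ne]
    omega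
  | and φ ψ ih₁ ih₂ =>
    obtain ⟨hφ, hψ, hw⟩ := hφ
    simp only [bounds, List.mem_append] at hB hw
    refine within_seq ((ih₁ hφ fun r hr => hB r (.inl hr)).imp fun s' hF h =>
      within_cond le_rfl (fun h1 => ?_) fun h1 => within_skip le_rfl ?_)
    · have harr : s'.arr = s.arr := funext fun b => hF.arr b (φ.eval_writesArr b)
      refine (ih₂ hψ fun r hr => ?_).imp fun s'' _ h' => ?_
      · rw [hF.reg r (hw r (.inr hr))]; exact hB r (.inr hr)
      · rw [h', holds_congr harr fun r hr => hF.reg r (hw r (.inl hr))]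
        simp [Holds, h.1 h1]
    · have : ¬ φ.Holds s := fun h' => h.2 h' h1
      simp [Holds, this, h1]
  | ex i n φ ih =>
    obtain ⟨hφ, hi1, hi2, hn1, hn2, hni, h1, h2, hi, hb, hf⟩ := hφ
    simp only [bounds, List.mem_cons, forall_eq_or_imp] at hB
    refine within_seq (within_instr _ le_rfl ?_)
    refine (within_forLoop_of_invariant (N := s.reg n) (fun j s' =>
      (s'.reg 1 ≠ 0 ↔ ∃ j', j ≤ j' ∧ j' < s.reg n ∧ φ.Holds (s.setReg i j')))
      (by simp [Instr.apply, hn1]) le_rfl (by simpa using hB.1) ?_ hi2 hn2 ?_ ?_ ?_).imp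
      fun s' _ h => by simpa [Holds] using h
    · simp [Program.writesReg, Program.skip, Instr.writesReg, hi2, hi]
    · rintro j s' r x (rfl | rfl) h <;> simpa [State.setReg, hi1.symm] using h
    · simp only [Instr.apply, Function.update_self, ne_eq, not_true_eq_false, false_iff]
      rintro ⟨j', h, h', -⟩
      omega
    · intro j hj s' hF hj' hI
      have hreg : ∀ r, r ≠ 1 → r ≠ 2 → r ≠ i → φ.eval.writesReg r = false →
          s'.reg r = s.reg r := by
        intro r hr1 hr2 hri hr
        rw [hF.reg r (by simp [Program.forLoop, Program.writesReg, Program.skip,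
          Instr.writesReg, hr2, hri, hr])]
        simp [Instr.apply, hr1]
      have harr : s'.arr = s.arr := funext fun b => by
        rw [hF.arr b (by simp [Program.forLoop, Program.writesArr, Program.skip,
          Instr.writesArr, eval_writesArr])]
        simp [Instr.apply]
      have hsat : φ.Holds s' ↔ φ.Holds (s.setReg i j) := holds_congr harr fun r hr => by
        by_cases hri : r = i
        · simp [hri, hj']
        · rw [hreg r (fun h => h1 (h ▸ hr)) (fun h => h2 (h ▸ hr)) hri (hf r hr)]
          simp [hri]
      have hsplit : (∃ j', j ≤ j' ∧ j' < s.reg n ∧ φ.Holds (s.setReg i j')) ↔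
          φ.Holds s' ∨ ∃ j', j + 1 ≤ j' ∧ j' < s.reg n ∧ φ.Holds (s.setReg i j') := by
        rw [hsat]
        constructor
        · rintro ⟨j', h, h', h''⟩
          rcases h.eq_or_lt with rfl | h
          · exact .inl h''
          · exact .inr ⟨j', h, h', h''⟩
        · rintro (h | ⟨j', h, h', h''⟩)
          · exact ⟨j, le_rfl, hj, h⟩
          · exact ⟨j', by omega, h', h''⟩
      refine within_cond le_rfl (fun h => within_skip le_rfl ?_) fun h => ?_
      · rw [hsplit, ← hI]
        simp [h]
      · refine (ih hφ fun r hr => ?_).imp fun s'' _ h' => ?_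
        · obtain ⟨hr1, hr2, hri, hr'⟩ := hb r hr
          rw [hreg r hr1 hr2 hri hr']
          exact hB.2 r hr
        · rw [hsplit, h', ← hI]
          simp [h]

end Formula

end RAM

/-! ### Dominant alternatives -/

namespace ApprovalProfile

variable {A V : Type}

/-- The property of a profile on which the greedy algorithm rests: among the remaining alternatives
`U` outside `D` that some active voter approves of, there are an active voter `v` and an alternative
`p` that `v` approves of such that no remaining alternative approved by `v` is approved by an active
voter who does not approve of `p`. -/
def HasDominant (P : ApprovalProfile A V) (D : Finset A) : Prop :=
  ∀ (U : Finset A) (act : Finset V), (∀ a ∈ U, a ∉ D) → (∃ v ∈ act, ∃ p ∈ U, p ∈ P v) →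
    ∃ v ∈ act, ∃ p ∈ U, p ∈ P v ∧ ∀ q ∈ U, q ∈ P v → ∀ u ∈ act, q ∈ P u → p ∈ P u

variable [DecidableEq A]

/-- In a single-peaked profile, the voter `v` whose last remaining alternative `p` comes first is
suitable: an active voter who approves of an alternative before `p` also approves of one at or after
`p`, and hence of `p`. -/
theorem SinglePeaked.hasDominant {P : ApprovalProfile A V} {D : Finset A}
    (h : (P.deleteAlternatives D).SinglePeaked) : P.HasDominant D := by
  classical
  obtain ⟨_, hP⟩ := h
  intro U act hU hex
  let F : V → Finset {a // a ∉ D} := fun u => (P u ∩ U).subtype (· ∉ D)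
  have hF : ∀ {u} {a : {a // a ∉ D}}, a ∈ F u ↔ a.1 ∈ P u ∧ a.1 ∈ U := by simp [F]
  let act' := act.filter fun u => (F u).Nonempty
  have hne : act'.Nonempty := by
    obtain ⟨v, hv, p, hp, hpv⟩ := hex
    exact ⟨v, by simpa [act', hv] using ⟨⟨p, hU p hp⟩, hF.2 ⟨hpv, hp⟩⟩⟩
  obtain ⟨v, hv, hmin⟩ := Finset.exists_min_image act' (fun u => (F u).max) hne
  obtain ⟨hv, hFv⟩ := Finset.mem_filter.1 hv
  obtain ⟨p, hp⟩ := Finset.max_of_nonempty hFv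
  have hpF := hF.1 (Finset.mem_of_max hp)
  refine ⟨v, hv, p.1, hpF.2, hpF.1, fun q hq hqv u hu hqu => ?_⟩
  have hqF : (⟨q, hU q hq⟩ : {a // a ∉ D}) ∈ F u := hF.2 ⟨hqu, hq⟩
  obtain ⟨w, hw⟩ := Finset.max_of_nonempty ⟨_, hqF⟩
  have h₁ : (⟨q, hU q hq⟩ : {a // a ∉ D}) ≤ p := by
    have : (⟨q, hU q hq⟩ : {a // a ∉ D}) ∈ F v := hF.2 ⟨hqv, hq⟩
    have := Finset.le_max this
    rwa [hp, WithBot.coe_le_coe] at this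
  have h₂ : p ≤ w := by
    have := hmin u (Finset.mem_filter.2 ⟨hu, ⟨_, hqF⟩⟩)
    rwa [hp, hw, WithBot.coe_le_coe] at this
  have := (hP u).out (x := ⟨q, hU q hq⟩) (by simpa [deleteAlternatives] using hqu) (y := w)
    (by simpa [deleteAlternatives] using (hF.1 (Finset.mem_of_max hw)).1) ⟨h₁, h₂⟩
  simpa [deleteAlternatives] using this

/-- In a single-crossing profile, the first active voter `v` who approves of a remaining alternative
is suitable, with an alternative `p` of `v` that is approved by active voters as far as possible:
between `v` and the last active voter who approves of `p`, everybody approves of `p`. -/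
theorem SingleCrossing.hasDominant {P : ApprovalProfile A V} {D : Finset A}
    (h : (P.deleteAlternatives D).SingleCrossing) : P.HasDominant D := by
  classical
  obtain ⟨_, hP⟩ := h
  intro U act hU hex
  let act' := act.filter fun u => ∃ p ∈ U, p ∈ P u
  have hne : act'.Nonempty := by
    obtain ⟨v, hv, hv'⟩ := hex
    exact ⟨v, Finset.mem_filter.2 ⟨hv, hv'⟩⟩
  obtain ⟨v, hv, hmin⟩ := Finset.exists_min_image act' id hne
  obtain ⟨hv, p₀, hp₀, hp₀v⟩ := Finset.mem_filter.1 hv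
  let F : A → Finset V := fun a => act.filter fun u => a ∈ P u
  obtain ⟨p, hp, hmax⟩ := Finset.exists_max_image (U.filter fun a => a ∈ P v)
    (fun a => (F a).max) ⟨p₀, Finset.mem_filter.2 ⟨hp₀, hp₀v⟩⟩
  obtain ⟨hp, hpv⟩ := Finset.mem_filter.1 hp
  refine ⟨v, hv, p, hp, hpv, fun q hq hqv u hu hqu => ?_⟩
  obtain ⟨w, hw⟩ := Finset.max_of_nonempty (s := F p) ⟨v, Finset.mem_filter.2 ⟨hv, hpv⟩⟩
  have h₁ : v ≤ u := hmin u (Finset.mem_filter.2 ⟨hu, q, hq, hqu⟩)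
  have h₂ : u ≤ w := by
    have h₃ := Finset.le_max (show u ∈ F q from Finset.mem_filter.2 ⟨hu, hqu⟩)
    have := h₃.trans (hmax q (Finset.mem_filter.2 ⟨hq, hqv⟩))
    rwa [hw, WithBot.coe_le_coe] at this
  have := (hP ⟨p, hU p hp⟩).out (x := v) (by simpa [deleteAlternatives] using hpv) (y := w)
    (by simpa [deleteAlternatives] using (Finset.mem_filter.1 (Finset.mem_of_max hw)).2) ⟨h₁, h₂⟩
  simpa [deleteAlternatives] using this

end ApprovalProfile

/-! ### The encoding of an instance -/

namespace MAVInstance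

open RAM

/-- The entry in column `a` of row `v` of the matrix that the encoding contains: the rows `v < n`
are the approval sets, and row `n` is the set of alternatives to be deleted. -/
def bit (I : MAVInstance) (v a : ℕ) : ℕ := I.encode.getD (4 + v * I.m + a) 0

theorem getD_flatten_ofFn {m : ℕ} : ∀ {n : ℕ} (f : Fin n → Fin m → ℕ) (l : List ℕ) (v : Fin n)
    (a : Fin m), ((List.ofFn fun v => List.ofFn (f v)).flatten ++ l).getD (v * m + a) 0 = f v a
  | 0, _, _, v, _ => v.elim0
  | n + 1, f, l, v, a => by
    rw [List.ofFn_succ, List.flatten_cons, List.append_assoc]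
    refine Fin.cases ?_ (fun v => ?_) v
    · rw [List.getD_append _ _ _ _ (by simp), List.getD_eq_getElem _ _ (by simp)]
      simp
    · rw [List.getD_append_right _ _ _ _ (by simp [add_mul]; omega)]
      have : ((v.succ : Fin (n + 1)) : ℕ) * m + a - (List.ofFn (f 0)).length = v * m + a := by
        simp [add_mul]; omega
      rw [this, getD_flatten_ofFn (fun v => f v.succ) l v a]

variable (I : MAVInstance)

theorem length_flatten_ofFn {m n : ℕ} (f : Fin n → Fin m → ℕ) :
    (List.ofFn fun v => List.ofFn (f v)).flatten.length = n * m := by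
  simp [List.length_flatten, List.map_ofFn, Function.comp_def]

theorem bit_profile (v : Fin I.n) (a : Fin I.m) :
    I.bit v a = if a ∈ I.profile v then 1 else 0 := by
  rw [bit, encode, List.append_assoc, List.getD_append_right _ _ _ _ (by simp; omega)]
  have : 4 + (v : ℕ) * I.m + a - [I.m, I.n, I.k, I.R].length = v * I.m + a := by
    simp only [List.length_cons, List.length_nil]; omega
  rw [this, getD_flatten_ofFn]

theorem bit_deleted (a : Fin I.m) : I.bit I.n a = if a ∈ I.deleted then 1 else 0 := by
  rw [bit, encode, List.getD_append_right _ _ _ _ (by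
    rw [List.length_append, length_flatten_ofFn]; simp)]
  rw [List.length_append, length_flatten_ofFn]
  have : 4 + I.n * I.m + (a : ℕ) - ([I.m, I.n, I.k, I.R].length + I.n * I.m) = a := by
    simp only [List.length_cons, List.length_nil]; omega
  rw [this, List.getD_eq_getElem _ _ (by simp)]
  simp

/-- Unless there are no alternatives, the numbers of alternatives and of voters are bounded by the
length of the input. -/
theorem le_inputLength : 4 + I.n * I.m + I.m ≤ inputLength I.encode := by
  have h : I.encode.length ≤ inputLength I.encode := by
    rw [inputLength]
    generalize I.encode = l
    induction l with
    | nil => simp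
    | cons a l ih => simp only [List.length_cons, List.map_cons, List.sum_cons]; omega
  refine le_trans (le_of_eq ?_) h
  rw [encode, List.length_append, List.length_append, length_flatten_ofFn]
  simp

/-! ### Reduction to the alternatives outside the deleted set -/

/-- The set `S` of deleted alternatives can be extended to a solution by alternatives that are not
deleted. -/
def Extends (S : Finset (Fin I.m)) : Prop :=
  ∃ X : Finset (Fin I.m), (∀ a ∈ X, a ∉ I.deleted) ∧ S.card + X.card ≤ I.k ∧
    ∀ v, (I.profile v).card + I.k - I.R - 2 * (I.profile v ∩ S).card ≤ 2 * (I.profile v ∩ X).card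

/-- If `W` has `k` elements, then the Hamming distance between `W` and an approval set `P` is
`|P| + k - 2 |P ∩ W|`. The condition that this is at most `R` is monotone in `W`, so it suffices
to find a set with at most `k` elements. -/
theorem isYes_iff : I.IsYes ↔ I.k ≤ I.m ∧ ∃ S ⊆ I.deleted, I.Extends S := by
  have hdist : ∀ (W : Finset (Fin I.m)), W.card = I.k → (I.profile.misrepresentation W ≤ I.R ↔
      ∀ v, (I.profile v).card + I.k ≤ I.R + 2 * (I.profile v ∩ W).card) := by
    intro W hW
    simp only [ApprovalProfile.misrepresentation, Finset.sup_le_iff, Finset.mem_univ, true_implies]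
    refine forall_congr' fun v => ?_
    have h₁ := Finset.card_sdiff_add_card_inter (I.profile v) W
    have h₂ := Finset.card_sdiff_add_card_inter W (I.profile v)
    rw [Finset.inter_comm] at h₂
    omega
  constructor
  · rintro ⟨W, hW, hR⟩
    rw [hdist W hW] at hR
    refine ⟨hW ▸ (by simpa using Finset.card_le_univ W), W ∩ I.deleted,
      Finset.inter_subset_right, W \ I.deleted, by simp, ?_, fun v => ?_⟩
    · have := Finset.card_sdiff_add_card_inter W I.deleted
      omega
    · have h₁ := hR v
      have h₂ := Finset.card_sdiff_add_card_inter (I.profile v ∩ W) I.deleted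
      rw [← Finset.inter_assoc, ← Finset.inter_sdiff_assoc]
      omega
  · rintro ⟨hk, S, hS, X, hX, hcard, hneed⟩
    have hdisj : Disjoint S X := Finset.disjoint_left.2 fun a ha ha' => hX a ha' (hS ha)
    obtain ⟨W, hSW, hW⟩ := Finset.exists_superset_card_eq (s := S ∪ X) (n := I.k)
      (by rwa [Finset.card_union_of_disjoint hdisj]) (by simpa using hk)
    refine ⟨W, hW, (hdist W hW).2 fun v => ?_⟩
    have h₁ := hneed v
    have h₂ : (I.profile v ∩ S).card + (I.profile v ∩ X).card ≤ (I.profile v ∩ W).card := by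
      rw [← Finset.card_union_of_disjoint (hdisj.mono Finset.inter_subset_right
        Finset.inter_subset_right), ← Finset.inter_union_distrib_left]
      exact Finset.card_le_card (Finset.inter_subset_inter_left hSW)
    omega

/-! ### The greedy algorithm -/

/-- The state of the greedy algorithm: twice the number of alternatives that a voter still needs
(up to rounding), a mark for the alternatives that are no longer available, and the number of
alternatives chosen so far. -/
structure Config where
  need : ℕ → ℕ
  used : ℕ → ℕ
  count : ℕ

/-- The configuration after alternative `p` is chosen. -/
def choose (p : ℕ) (g : Config) : Config where
  need := fun v => if v < I.n then g.need v - I.bit v p - I.bit v p else g.need v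
  used := Function.update g.used p 1
  count := g.count + 1

/-- The configuration can be completed to a solution. -/
def Completable (g : Config) : Prop :=
  ∃ X : Finset (Fin I.m), (∀ a ∈ X, g.used a = 0) ∧ g.count + X.card ≤ I.k ∧
    ∀ v : Fin I.n, g.need v ≤ 2 * (I.profile v ∩ X).card

/-- The alternative `p` is available and, for some active voter, a best choice among the available
alternatives. -/
def Dominant (p : ℕ) (g : Config) : Prop :=
  g.used p = 0 ∧ ∃ v < I.n, g.need v ≠ 0 ∧ I.bit v p ≠ 0 ∧ ∀ q < I.m, g.used q = 0 →
    I.bit v q ≠ 0 → ∀ u < I.n, g.need u ≠ 0 → I.bit u q ≠ 0 → I.bit u p ≠ 0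

variable {I}

/-- The exchange argument: a solution must contain an alternative of the voter for whom `p` is a
best choice, and it can be replaced by `p`. -/
theorem completable_choose {p : ℕ} (hp : p < I.m) {g : Config} (h : I.Dominant p g) :
    I.Completable (I.choose p g) ↔ I.Completable g := by
  obtain ⟨p, rfl⟩ : ∃ p' : Fin I.m, (p' : ℕ) = p := ⟨⟨p, hp⟩, rfl⟩
  have hneed : ∀ v : Fin I.n, (I.choose p g).need v
      = if p ∈ I.profile v then g.need v - 2 else g.need v := by
    intro v
    simp only [choose, v.2, if_true, bit_profile]
    split_ifs <;> omega
  constructor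
  · rintro ⟨X, hX, hcard, hX'⟩
    have hpX : p ∉ X := fun hpX => by simpa [choose] using hX p hpX
    refine ⟨insert p X, ?_, ?_, fun v => ?_⟩
    · intro a ha
      rcases Finset.mem_insert.1 ha with rfl | ha
      · exact h.1
      · have hne : (a : ℕ) ≠ p := fun h => hpX (Fin.ext h ▸ ha)
        simpa [choose, hne] using hX a ha
    · rw [Finset.card_insert_of_notMem hpX]
      simp only [choose] at hcard
      omega
    · have := hX' v
      rw [hneed] at this
      by_cases hpv : p ∈ I.profile v
      · rw [Finset.inter_insert_of_mem hpv, Finset.card_insert_of_notMem (by simp [hpX])]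
        rw [if_pos hpv] at this
        omega
      · rw [if_neg hpv] at this
        rwa [Finset.inter_insert_of_notMem hpv]
  · rintro ⟨X, hX, hcard, hX'⟩
    obtain ⟨-, v, hv, hnv, hbv, hdom⟩ := h
    obtain ⟨v, rfl⟩ : ∃ v' : Fin I.n, (v' : ℕ) = v := ⟨⟨v, hv⟩, rfl⟩
    have hbit : ∀ (u : Fin I.n) (a : Fin I.m), I.bit u a ≠ 0 ↔ a ∈ I.profile u := by
      intro u a
      rw [bit_profile]
      split_ifs <;> simp_all
    rw [hbit] at hbv
    -- an alternative of the solution that may be exchanged for `p`; it is `p` itself if possible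
    obtain ⟨q, hqX, hqv, hq⟩ : ∃ q ∈ X, q ∈ I.profile v ∧ (p ∈ X → q = p) := by
      by_cases hpX : p ∈ X
      · exact ⟨p, hpX, hbv, fun _ => rfl⟩
      · have : (I.profile v ∩ X).Nonempty := by
          rw [← Finset.card_pos]
          have := hX' v
          omega
        obtain ⟨q, hq⟩ := this
        exact ⟨q, (Finset.mem_inter.1 hq).2, (Finset.mem_inter.1 hq).1, fun h => absurd h hpX⟩
    have hpq : p ∉ X.erase q := fun h =>
      Finset.ne_of_mem_erase h (hq (Finset.mem_of_mem_erase h)).symm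
    refine ⟨X.erase q, ?_, ?_, fun u => ?_⟩
    · intro a ha
      have hne : (a : ℕ) ≠ p := fun h => hpq (Fin.ext h ▸ ha)
      simpa [choose, hne] using hX a (Finset.mem_of_mem_erase ha)
    · have := Finset.card_erase_add_one hqX
      simp only [choose]
      omega
    · rw [hneed, Finset.inter_erase]
      have h₁ := hX' u
      by_cases hu : g.need u = 0
      · split_ifs <;> omega
      · have h₂ : q ∈ I.profile u → p ∈ I.profile u := by
          intro h
          rw [← hbit] at h hqv ⊢
          exact hdom q q.2 (hX q hqX) hqv u u.2 hu h
        have h₃ := Finset.pred_card_le_card_erase (s := I.profile u ∩ X) (a := q)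
        by_cases hqu : q ∈ I.profile u
        · rw [if_pos (h₂ hqu)]
          omega
        · rw [Finset.erase_eq_of_notMem (by simp [hqu])]
          split_ifs <;> omega

variable (I)

open Classical in
/-- Choose `p` if it is dominant. -/
noncomputable def greedyStep (p : ℕ) (g : Config) : Config :=
  if I.Dominant p g then I.choose p g else g

/-- `m` passes over all alternatives. -/
noncomputable def greedy (g : Config) : Config :=
  iterDown (fun _ => iterDown I.greedyStep I.m) I.m g

/-- All voters are satisfied, and at most `k` alternatives are chosen. -/
def Success (g : Config) : Prop := g.count ≤ I.k ∧ ∀ v < I.n, g.need v = 0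

/-- The number of available alternatives. -/
def available (g : Config) : ℕ := ((Finset.range I.m).filter fun a => g.used a = 0).card

variable {I}

theorem iterDown_invariant {α : Type*} {f : ℕ → α → α} {p : α → Prop} {N : ℕ}
    (h : ∀ j < N, ∀ a, p a → p (f j a)) {a : α} (ha : p a) : p (iterDown f N a) := by
  induction N generalizing a with
  | zero => exact ha
  | succ N ih => exact ih (fun j hj => h j (by omega)) (h N (by omega) a ha)

theorem completable_greedyStep {p : ℕ} (hp : p < I.m) (g : Config) :
    I.Completable (I.greedyStep p g) ↔ I.Completable g := by
  unfold greedyStep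
  split_ifs with h
  · exact completable_choose hp h
  · rfl

theorem used_of_greedyStep {p a : ℕ} {g : Config} (h : (I.greedyStep p g).used a = 0) :
    g.used a = 0 := by
  unfold greedyStep at h
  split_ifs at h
  · by_cases hap : a = p <;> simp_all [choose]
  · exact h

theorem available_greedyStep_le (p : ℕ) (g : Config) :
    I.available (I.greedyStep p g) ≤ I.available g :=
  Finset.card_le_card fun a ha => by
    rw [Finset.mem_filter] at ha ⊢
    exact ⟨ha.1, used_of_greedyStep ha.2⟩

theorem available_greedyStep_lt {p : ℕ} (hp : p < I.m) {g : Config} (h : I.Dominant p g) :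
    I.available (I.greedyStep p g) < I.available g := by
  refine Finset.card_lt_card ((Finset.ssubset_iff_of_subset fun a ha => ?_).2 ⟨p, ?_, ?_⟩)
  · rw [Finset.mem_filter] at ha ⊢
    exact ⟨ha.1, used_of_greedyStep ha.2⟩
  · simp [hp, h.1]
  · simp [greedyStep, h, choose]

theorem available_pass_le (g : Config) (N : ℕ) :
    I.available (iterDown I.greedyStep N g) ≤ I.available g :=
  iterDown_invariant (p := fun g' => I.available g' ≤ I.available g)
    (fun j _ g' h => (available_greedyStep_le j g').trans h) le_rfl

/-- A pass over the alternatives either finds no dominant one, or it uses some. -/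
theorem pass_eq_or_lt (g : Config) {N : ℕ} (hN : N ≤ I.m) :
    ((∀ p < N, ¬ I.Dominant p g) ∧ iterDown I.greedyStep N g = g) ∨
      I.available (iterDown I.greedyStep N g) < I.available g := by
  induction N with
  | zero => exact .inl ⟨by simp, rfl⟩
  | succ N ih =>
    rw [iterDown]
    by_cases h : I.Dominant N g
    · exact .inr ((available_pass_le _ _).trans_lt (available_greedyStep_lt (by omega) h))
    · rw [show I.greedyStep N g = g by simp [greedyStep, h]]
      refine (ih (by omega)).imp_left fun h' => ⟨fun p hp => ?_, h'.2⟩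
      rcases Nat.lt_succ_iff_lt_or_eq.1 hp with hp | rfl
      exacts [h'.1 p hp, h]

/-- `m` passes suffice, because every pass that finds a dominant alternative uses one of at most `m`
available alternatives. -/
theorem greedy_not_dominant (g : Config) : ∀ p < I.m, ¬ I.Dominant p (I.greedy g) := by
  have key : ∀ (N : ℕ) (g : Config), (∀ p < I.m, ¬ I.Dominant p g) ∨ I.available g ≤ N →
      ∀ p < I.m, ¬ I.Dominant p (iterDown (fun _ => iterDown I.greedyStep I.m) N g) := by
    intro N
    induction N with
    | zero =>
      rintro g (h | h) p hp
      · exact h p hp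
      · intro hd
        have := available_greedyStep_lt hp hd
        simp only [iterDown] at this
        omega
    | succ N ih =>
      intro g h
      rw [iterDown]
      refine ih _ ?_
      rcases pass_eq_or_lt g le_rfl with ⟨h', he⟩ | h'
      · rw [he]
        exact .inl h'
      · rcases h with h | h
        · have : iterDown I.greedyStep I.m g = g :=
            iterDown_invariant (p := fun g' => g' = g)
              (fun j hj a ha => by rw [ha, greedyStep, if_neg (h j hj)]) rfl
          rw [this]
          exact .inl h
        · exact .inr (by omega)
  exact key I.m g (.inr ((Finset.card_filter_le _ _).trans (by simp)))

/-- The greedy algorithm is correct: when it stops, no active voter approves of an available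
alternative. -/
theorem success_greedy_iff (hI : I.profile.HasDominant I.deleted) {g : Config}
    (hg : ∀ a ∈ I.deleted, g.used a ≠ 0) : I.Success (I.greedy g) ↔ I.Completable g := by
  have hc : I.Completable (I.greedy g) ↔ I.Completable g :=
    iterDown_invariant (p := fun g' => I.Completable g' ↔ I.Completable g)
      (fun _ _ g' h => iterDown_invariant (p := fun g' => I.Completable g' ↔ I.Completable g)
        (fun j hj g' h => (completable_greedyStep hj g').trans h) h) Iff.rfl
  have hused : ∀ a ∈ I.deleted, (I.greedy g).used a ≠ 0 := fun a ha =>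
    iterDown_invariant (p := fun g' : Config => g'.used a ≠ 0)
      (fun _ _ g' h => iterDown_invariant (p := fun g' : Config => g'.used a ≠ 0)
        (fun j hj g' h h' => h (used_of_greedyStep h')) h) (hg a ha)
  have hstuck := greedy_not_dominant (I := I) g
  rw [← hc]
  generalize I.greedy g = g at hused hstuck
  constructor
  · rintro ⟨h₁, h₂⟩
    exact ⟨∅, by simp, by simpa using h₁, fun v => by simp [h₂ v v.2]⟩
  · rintro ⟨X, hX, hcard, hX'⟩
    refine ⟨by omega, ?_⟩
    by_contra! hne
    obtain ⟨v, hv, hnv⟩ := hne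
    have hpos : (I.profile ⟨v, hv⟩ ∩ X).Nonempty := by
      rw [← Finset.card_pos]
      have := hX' ⟨v, hv⟩
      simp only at this
      omega
    obtain ⟨p, hp⟩ := hpos
    rw [Finset.mem_inter] at hp
    obtain ⟨v, hv, p, hp, hpv, hdom⟩ := hI (Finset.univ.filter fun a => g.used a = 0)
      (Finset.univ.filter fun u => g.need u ≠ 0)
      (fun a ha hd => hused a hd (Finset.mem_filter.1 ha).2)
      ⟨⟨v, hv⟩, by simpa using hnv, p, by simpa using hX p hp.2, hp.1⟩
    refine hstuck p p.2 ⟨(Finset.mem_filter.1 hp).2, v, v.2, (Finset.mem_filter.1 hv).2, ?_, ?_⟩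
    · simp [bit_profile, hpv]
    · intro q hq hqu hqv u hu hnu hqu'
      have h₁ := I.bit_profile v ⟨q, hq⟩
      have h₂ := I.bit_profile ⟨u, hu⟩ ⟨q, hq⟩
      have h₃ := I.bit_profile ⟨u, hu⟩ p
      simp only at h₁ h₂ h₃
      rw [h₃, if_pos]
      · exact one_ne_zero
      · refine hdom ⟨q, hq⟩ (by simpa using hqu) ?_ ⟨u, hu⟩ (by simpa using hnu) ?_
        · by_contra hn
          exact hqv (by rw [h₁, if_neg hn])
        · by_contra hn
          exact hqu' (by rw [h₂, if_neg hn])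

end MAVInstance

/-! ### Enumeration of the subsets of the deleted set -/

namespace MAVInstance

open RAM

/-- The configuration in which exactly the deleted alternatives are unavailable, and those in `S`
are chosen. -/
structure Represents (I : MAVInstance) (S : Finset (Fin I.m)) (g : Config) : Prop where
  need : ∀ v : Fin I.n,
    g.need v = (I.profile v).card + I.k - I.R - 2 * (I.profile v ∩ S).card
  used : ∀ a : Fin I.m, g.used a = if a ∈ I.deleted then 1 else 0
  count : g.count = S.card

variable {I : MAVInstance}

theorem Represents.completable_iff {S : Finset (Fin I.m)} {g : Config} (h : I.Represents S g) :
    I.Completable g ↔ I.Extends S := by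
  simp only [Completable, Extends, h.need, h.used, h.count]
  simp

theorem Represents.choose {S : Finset (Fin I.m)} {g : Config} (h : I.Represents S g)
    {p : Fin I.m} (hp : p ∈ I.deleted) (hpS : p ∉ S) :
    I.Represents (S ∪ {p}) (I.choose p g) := by
  rw [Finset.union_comm, ← Finset.insert_eq]
  refine ⟨fun v => ?_, fun a => ?_, ?_⟩
  · simp only [MAVInstance.choose, v.2, if_true, bit_profile, h.need]
    by_cases hpv : p ∈ I.profile v
    · rw [Finset.inter_insert_of_mem hpv, Finset.card_insert_of_notMem (by simp [hpS]), if_pos hpv]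
      omega
    · rw [Finset.inter_insert_of_notMem hpv, if_neg hpv]
      omega
  · by_cases hap : a = p
    · simp [MAVInstance.choose, hap, hp]
    · have hne : (a : ℕ) ≠ p := fun h => hap (Fin.ext h)
      simp [MAVInstance.choose, hne, h.used]
  · simp [MAVInstance.choose, h.count, Finset.card_insert_of_notMem hpS]

variable (I)

/-- One step of the decoding of a number `x < T`, where `T` is a power of 2, into a set of deleted
alternatives: if alternative `a` is deleted, then the leading bit of `x` is shifted out and says
whether `a` belongs to the set. -/
def setStep (T a : ℕ) (y : ℕ × Finset (Fin I.m)) : ℕ × Finset (Fin I.m) :=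
  if I.bit I.n a = 0 then y
  else if T ≤ y.1 + y.1 then (y.1 + y.1 - T, y.2 ∪ Finset.univ.filter fun b => (b : ℕ) = a)
  else (y.1 + y.1, y.2)

/-- The set of deleted alternatives that the number `c` encodes. -/
def decodeSet (c : ℕ) : Finset (Fin I.m) :=
  (iterDown (I.setStep (2 ^ I.deleted.card)) I.m (c, ∅)).2

/-- The decoding on the level of configurations. -/
def decodeStep (T a : ℕ) (y : ℕ × Config) : ℕ × Config :=
  if I.bit I.n a = 0 then y
  else if T ≤ y.1 + y.1 then (y.1 + y.1 - T, I.choose a y.2)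
  else (y.1 + y.1, y.2)

variable {I}

/-- Decoding a number into a set and decoding it into a configuration agree. The set does not depend
on the previous contents of the arrays, which survive in the configuration. -/
theorem represents_iterDown {T : ℕ} {N : ℕ} (hN : N ≤ I.m) (x : ℕ) {S : Finset (Fin I.m)}
    {g : Config} (h : I.Represents S g) (hS : ∀ a ∈ S, N ≤ (a : ℕ)) :
    I.Represents (iterDown (I.setStep T) N (x, S)).2 (iterDown (I.decodeStep T) N (x, g)).2 := by
  induction N generalizing x S g with
  | zero => exact h
  | succ N ih =>
    have hN' : N < I.m := by omega
    have hbit : I.bit I.n N = _ := I.bit_deleted ⟨N, hN'⟩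
    simp only [iterDown, setStep, decodeStep]
    by_cases hd : (⟨N, hN'⟩ : Fin I.m) ∈ I.deleted
    · have hfilter : (Finset.univ.filter fun b : Fin I.m => (b : ℕ) = N) = {⟨N, hN'⟩} := by
        ext b; simp [Fin.ext_iff]
      rw [if_pos hd] at hbit
      simp only [hbit, one_ne_zero, if_false, hfilter]
      split_ifs
      · refine ih (by omega) _ (h.choose hd fun hm => ?_) fun a ha => ?_
        · have := hS _ hm
          simp only at this
          omega
        · rcases Finset.mem_union.1 ha with ha | ha
          · have := hS a ha
            omega
          · rw [Finset.mem_singleton.1 ha]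
      · exact ih (by omega) _ h fun a ha => by have := hS a ha; omega
    · rw [if_neg hd] at hbit
      simp only [hbit, if_true]
      exact ih (by omega) _ h fun a ha => by have := hS a ha; omega

theorem decodeSet_subset (c : ℕ) : I.decodeSet c ⊆ I.deleted := by
  refine iterDown_invariant (p := fun y : ℕ × Finset (Fin I.m) => y.2 ⊆ I.deleted)
    (fun j hj y hy => ?_) (Finset.empty_subset _)
  have hbit : I.bit I.n j = _ := I.bit_deleted ⟨j, hj⟩
  unfold setStep
  split_ifs with h₁ h₂
  · exact hy
  · refine Finset.union_subset hy fun b hb => ?_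
    obtain rfl : b = ⟨j, hj⟩ := Fin.ext (by simpa using hb)
    by_contra hn
    rw [if_neg hn] at hbit
    exact h₁ hbit
  · exact hy

/-- Every set `S` of deleted alternatives is encoded by some number. When the alternatives from `N`
on are done, the number is a multiple of `2 ^ (t - d)`, where `d` is the number of the
deleted alternatives that remain. -/
theorem exists_decodeSet_eq {S : Finset (Fin I.m)} (hS : S ⊆ I.deleted) :
    ∃ c < 2 ^ I.deleted.card, I.decodeSet c = S := by
  set D := I.deleted with hD
  let d : ℕ → ℕ := fun N => (D.filter fun a : Fin I.m => (a : ℕ) < N).card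
  have hd : ∀ N, d N ≤ D.card := fun N => Finset.card_filter_le _ _
  have key : ∀ N ≤ I.m, ∀ S ⊆ D, (∀ a ∈ S, (a : ℕ) < N) → ∀ S₀, ∃ y < 2 ^ d N,
      (iterDown (I.setStep (2 ^ D.card)) N (y * 2 ^ (D.card - d N), S₀)).2 = S₀ ∪ S := by
    intro N
    induction N with
    | zero =>
      intro _ S _ hS S₀
      have : S = ∅ := Finset.eq_empty_of_forall_notMem fun a ha => by simpa using hS a ha
      exact ⟨0, by positivity, by simp [iterDown, this]⟩
    | succ N ih =>
      intro hN S hSD hS S₀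
      have hN' : N < I.m := by omega
      have hbit : I.bit I.n N = _ := I.bit_deleted ⟨N, hN'⟩
      by_cases hND : (⟨N, hN'⟩ : Fin I.m) ∈ D
      · have hdN : d (N + 1) = d N + 1 := by
          have : (D.filter fun a : Fin I.m => (a : ℕ) < N + 1)
              = insert ⟨N, hN'⟩ (D.filter fun a : Fin I.m => (a : ℕ) < N) := by
            ext a
            simp only [Finset.mem_filter, Finset.mem_insert, Fin.ext_iff, Nat.lt_succ_iff_lt_or_eq]
            constructor
            · rintro ⟨h, h' | h'⟩
              exacts [.inr ⟨h, h'⟩, .inl h']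
            · rintro (h | ⟨h, h'⟩)
              · exact ⟨by rwa [show a = ⟨N, hN'⟩ from Fin.ext h], .inr h⟩
              · exact ⟨h, .inl h'⟩
          simp only [d, this]
          rw [Finset.card_insert_of_notMem (by simp)]
        have hle := hd (N + 1)
        have hpow : 2 ^ (D.card - d N) = 2 * 2 ^ (D.card - d (N + 1)) := by
          rw [← pow_succ', hdN]
          congr 1
          omega
        have htop : 2 ^ d N * 2 ^ (D.card - d N) = 2 ^ D.card := by
          rw [← pow_add]
          congr 1
          omega
        have hfilter : (Finset.univ.filter fun b : Fin I.m => (b : ℕ) = N) = {⟨N, hN'⟩} := by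
          ext b; simp [Fin.ext_iff]
        rw [if_pos (hD ▸ hND)] at hbit
        by_cases hNS : (⟨N, hN'⟩ : Fin I.m) ∈ S
        · obtain ⟨y, hy, he⟩ := ih (by omega) (S.erase ⟨N, hN'⟩)
            ((Finset.erase_subset _ _).trans hSD) (fun a ha => by
              have h₁ := hS a (Finset.mem_of_mem_erase ha)
              have h₂ := Finset.ne_of_mem_erase ha
              rw [Ne, Fin.ext_iff] at h₂
              simp only at h₂
              omega) (S₀ ∪ {⟨N, hN'⟩})
          refine ⟨2 ^ d N + y, by rw [hdN, pow_succ]; omega, ?_⟩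
          have hdouble : (2 ^ d N + y) * 2 ^ (D.card - d (N + 1))
              + (2 ^ d N + y) * 2 ^ (D.card - d (N + 1))
              = 2 ^ D.card + y * 2 ^ (D.card - d N) := by
            rw [← htop, hpow]; ring
          simp only [iterDown, setStep, hbit, one_ne_zero, if_false, hdouble, hfilter]
          rw [if_pos (by omega), Nat.add_sub_cancel_left, he, Finset.union_assoc,
            ← Finset.insert_eq, Finset.insert_erase hNS]
        · obtain ⟨y, hy, he⟩ := ih (by omega) S hSD (fun a ha => by
              have h₁ := hS a ha
              have h₂ : a ≠ ⟨N, hN'⟩ := fun h => hNS (h ▸ ha)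
              rw [Ne, Fin.ext_iff] at h₂
              simp only at h₂
              omega) S₀
          refine ⟨y, by rw [hdN, pow_succ]; omega, ?_⟩
          have hdouble : y * 2 ^ (D.card - d (N + 1)) + y * 2 ^ (D.card - d (N + 1))
              = y * 2 ^ (D.card - d N) := by
            rw [hpow]; ring
          have hlt : y * 2 ^ (D.card - d N) < 2 ^ D.card := by
            rw [← htop]
            exact Nat.mul_lt_mul_of_pos_right hy (by positivity)
          simp only [iterDown, setStep, hbit, one_ne_zero, if_false, hdouble]
          rw [if_neg (by omega), he]
      · have hdN : d (N + 1) = d N := by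
          have : (D.filter fun a : Fin I.m => (a : ℕ) < N + 1)
              = D.filter fun a : Fin I.m => (a : ℕ) < N := by
            refine Finset.filter_congr fun a ha => ?_
            have : a ≠ ⟨N, hN'⟩ := fun h => hND (h ▸ ha)
            rw [Ne, Fin.ext_iff] at this
            simp only at this
            omega
          simp only [d, this]
        obtain ⟨y, hy, he⟩ := ih (by omega) S hSD (fun a ha => by
          have h₁ := hS a ha
          have h₂ : a ≠ ⟨N, hN'⟩ := fun h => hND (h ▸ hSD ha)
          rw [Ne, Fin.ext_iff] at h₂
          simp only at h₂
          omega) S₀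
        rw [if_neg (hD ▸ hND)] at hbit
        refine ⟨y, by rwa [hdN], ?_⟩
        simp only [iterDown, setStep, hbit, if_true]
        rw [hdN, he]
  obtain ⟨y, hy, he⟩ := key I.m le_rfl S hS (fun a _ => a.2) ∅
  have hdm : d I.m = D.card := by
    simp only [d]
    rw [Finset.filter_true_of_mem fun a _ => a.2]
  rw [hdm] at hy he
  exact ⟨y, hy, by simpa [decodeSet, ← hD] using he⟩

theorem isYes_iff_exists_lt : I.IsYes ↔
    I.k ≤ I.m ∧ ∃ c < 2 ^ I.deleted.card, I.Extends (I.decodeSet c) := by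
  rw [isYes_iff]
  refine and_congr_right fun _ => ⟨?_, ?_⟩
  · rintro ⟨S, hS, h⟩
    obtain ⟨c, hc, rfl⟩ := exists_decodeSet_eq hS
    exact ⟨c, hc, h⟩
  · rintro ⟨c, -, h⟩
    exact ⟨_, decodeSet_subset c, h⟩

variable (I)

/-- The configuration before any alternative is chosen. What the arrays of `g` contain outside of
the ranges of voters and alternatives is kept. -/
def start (g : Config) : Config where
  need := fun v => if v < I.n then I.k + ∑ a ∈ Finset.range I.m, I.bit v a - I.R else g.need v
  used := fun a => if a < I.m then I.bit I.n a else g.used a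
  count := 0

theorem represents_start (g : Config) : I.Represents ∅ (I.start g) := by
  refine ⟨fun v => ?_, fun a => ?_, rfl⟩
  · have : ∑ a ∈ Finset.range I.m, I.bit v a = (I.profile v).card := by
      rw [Finset.sum_range fun a => I.bit v a]
      simp [bit_profile]
    simp [start, this, add_comm]
  · simp [start, bit_deleted]

end MAVInstance

/-! ### The program -/

/-! Register 0 holds the answer, registers 1 and 2 are auxiliary, registers 3 to 6 hold `m`, `n`, `k`
and `R`, register 7 holds `2 ^ t`, and register 8 the number that encodes the current set of
deleted alternatives. A configuration of the greedy algorithm is kept in array 2 (`need`), array 3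
(`used`) and register 10 (`count`). Array 1 holds the addresses of the rows of the matrix in the
input, array 0. -/

namespace MAVInstance

open RAM RAM.Program

/-- Register 1 becomes the entry of the matrix in the row and the column that are in the registers
`x` and `y`. -/
def readEntry (x y : ℕ) : Program :=
  seq (instr (.load 1 1 x)) (seq (instr (.add 1 1 y)) (instr (.load 1 0 1)))

/-- Choose the alternative in register 12. -/
def chooseProg : Program :=
  seq (forLoop 13 4 (seq (readEntry 13 12) (seq (instr (.load 16 2 13))
      (seq (instr (.sub 16 16 1)) (seq (instr (.sub 16 16 1)) (instr (.store 2 13 16)))))))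
    (seq (instr (.const 1 1)) (seq (instr (.store 3 12 1)) (instr (.add 10 10 1))))

/-- Produce the configuration `start`. -/
def startProg : Program :=
  seq (forLoop 13 4 (seq (instr (.const 2 0)) (seq (instr (.add 9 5 2))
      (seq (forLoop 12 3 (seq (readEntry 13 12) (instr (.add 9 9 1))))
        (seq (instr (.sub 9 9 6)) (instr (.store 2 13 9)))))))
    (seq (forLoop 12 3 (seq (readEntry 4 12) (instr (.store 3 12 1)))) (instr (.const 10 0)))

/-- Choose the deleted alternatives that belong to the set encoded by register 8. The comparison of
the doubled number in register 9 with `2 ^ t` is a truncated subtraction. -/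
def decodeProg : Program :=
  seq (instr (.const 2 0)) (seq (instr (.add 9 8 2))
    (forLoop 12 3 (seq (readEntry 4 12) (.cond 1
      (seq (instr (.add 9 9 9)) (seq (instr (.sub 1 7 9))
        (.cond 1 skip (seq (instr (.sub 9 9 7)) chooseProg))))
      skip))))

/-- The alternative in register 12 is dominant. -/
def dominantFormula : Formula :=
  .and (.not (.cell 3 12)) (.ex 13 4 (.and (.cell 2 13) (.and (.entry 13 12)
    (.not (.ex 14 3 (.and (.not (.cell 3 14)) (.and (.entry 13 14)
      (.ex 15 4 (.and (.cell 2 15) (.and (.entry 15 14) (.not (.entry 15 12))))))))))))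

/-- `m` passes over all alternatives, which choose the dominant ones. -/
def greedyProg : Program :=
  forLoop 11 3 (forLoop 12 3 (seq dominantFormula.eval (.cond 1 chooseProg skip)))

/-- The answer becomes 1 if the configuration is a success. -/
def checkProg : Program :=
  seq (Formula.ex 13 4 (.cell 2 13)).eval
    (.cond 1 skip (seq (instr (.sub 1 10 5)) (.cond 1 skip (instr (.const 0 1)))))

/-- Treat the set of deleted alternatives that is encoded by register 8. -/
def trialProg : Program :=
  seq startProg (seq decodeProg (seq greedyProg checkProg))

/-- Fill the registers 3 to 6. -/
def readProg : Program :=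
  seq (seq (instr (.const 1 0)) (instr (.load 3 0 1)))
    (seq (seq (instr (.const 1 1)) (instr (.load 4 0 1)))
      (seq (seq (instr (.const 1 2)) (instr (.load 5 0 1)))
        (seq (instr (.const 1 3)) (instr (.load 6 0 1)))))

/-- Fill array 1 with the addresses of the `n + 1` rows. -/
def rowsProg : Program :=
  seq (instr (.const 9 4)) (seq (instr (.const 10 0)) (seq (instr (.const 1 1))
    (seq (instr (.add 16 4 1)) (forLoop 11 16 (seq (instr (.store 1 10 9))
      (seq (instr (.add 9 9 3)) (seq (instr (.const 1 1)) (instr (.add 10 10 1)))))))))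

/-- Register 7 becomes 2 to the power of the number of deleted alternatives. -/
def powProg : Program :=
  seq (instr (.const 7 1)) (forLoop 12 3 (seq (readEntry 4 12) (.cond 1 (instr (.add 7 7 7)) skip)))

/-- The decision procedure. Without alternatives, the number of voters can be exponential in the
length of the input, and the answer depends on `k` only. -/
def mavProg : Program :=
  seq readProg (.cond 3
    (seq (instr (.sub 1 5 3)) (.cond 1 skip
      (seq rowsProg (seq powProg (forLoop 8 7 trialProg)))))
    (seq (instr (.const 1 1)) (instr (.sub 0 1 5))))

/-! ### Correctness of the program -/

/-- The registers and arrays that describe the instance have their values. -/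
structure Ready (I : MAVInstance) (s : State) : Prop where
  m : s.reg 3 = I.m
  n : s.reg 4 = I.n
  k : s.reg 5 = I.k
  R : s.reg 6 = I.R
  entry : ∀ v ≤ I.n, ∀ a, s.arr 0 (s.arr 1 v + a) = I.bit v a

/-- The program does not change the description of the instance. -/
def KeepsInput (p : Program) : Prop :=
  (p.writesReg 3 = false ∧ p.writesReg 4 = false ∧ p.writesReg 5 = false ∧
    p.writesReg 6 = false) ∧ p.writesArr 0 = false ∧ p.writesArr 1 = false

instance (p : Program) : Decidable (KeepsInput p) :=
  inferInstanceAs (Decidable (_ ∧ _))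

/-- The configuration that is stored in a state. -/
def config (s : State) : Config := ⟨s.arr 2, s.arr 3, s.reg 10⟩

variable {I : MAVInstance} {B F : ℕ} {s : State} {Q : State → Prop}

theorem Ready.frame {s' : State} {p : Program} (h : I.Ready s) (hF : Frame p s s')
    (hp : KeepsInput p) : I.Ready s' := by
  obtain ⟨⟨h3, h4, h5, h6⟩, h0, h1⟩ := hp
  exact ⟨(hF.reg 3 h3).trans h.m, (hF.reg 4 h4).trans h.n, (hF.reg 5 h5).trans h.k,
    (hF.reg 6 h6).trans h.R, by rw [hF.arr 0 h0, hF.arr 1 h1]; exact h.entry⟩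

theorem Ready.apply (h : I.Ready s) (i : Instr) (hi : KeepsInput (instr i)) :
    I.Ready (i.apply s) :=
  h.frame (i.frame s) hi

theorem within_readEntry (h : I.Ready s) {x y v a : ℕ} (hx : s.reg x = v) (hy : s.reg y = a)
    (hv : v ≤ I.n) (hy1 : y ≠ 1) (hF : 1 ≤ F) (hQ : Q (s.setReg 1 (I.bit v a))) :
    Within F B (readEntry x y) Q s := by
  refine within_seq (within_instr _ hF (within_seq (within_instr _ hF (within_instr _ hF ?_))))
  simpa [Instr.apply, hx, hy, hy1, h.entry v hv] using hQ

theorem within_chooseProg (hn : I.n ≤ B) (h : I.Ready s) {p : ℕ} (hp : s.reg 12 = p) :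
    Within 1 B chooseProg (fun s' => config s' = I.choose p (config s)) s := by
  refine within_seq ((within_forLoop (fun s => s.arr 2)
    (fun v e => Function.update e v (e v - I.bit v p - I.bit v p))
    h.n le_rfl (by simpa using hn) (by decide) (by decide) (by decide) (by simp) ?_).imp
    fun s' hF hs' => ?_)
  · intro v hv s' hF hv'
    have h' := h.frame hF (by decide)
    refine within_seq (within_readEntry h' hv' ((hF.reg 12 (by decide)).trans hp) hv.le
      (by decide) le_rfl ?_)
    iterate 3 refine within_seq (within_instr _ le_rfl ?_)
    refine within_instr _ le_rfl ?_
    simp [Instr.apply, hv']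
  · rw [iterDown_update fun v x => x - I.bit v p - I.bit v p] at hs'
    iterate 2 refine within_seq (within_instr _ le_rfl ?_)
    refine within_instr _ le_rfl ?_
    simp [Instr.apply, config, choose, hs', hF.arr 3 (by decide), hF.reg 12 (by decide),
      hF.reg 10 (by decide), hp]

theorem within_startProg (hm : I.m ≤ B) (hn : I.n ≤ B) (h : I.Ready s) :
    Within 1 B startProg (fun s' => config s' = I.start (config s)) s := by
  refine within_seq ((within_forLoop (fun s => s.arr 2)
    (fun v e => Function.update e v (I.k + ∑ a ∈ Finset.range I.m, I.bit v a - I.R))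
    h.n le_rfl (by simpa using hn) (by decide) (by decide) (by decide) (by simp) ?_).imp
    fun s₁ hF₁ hs₁ => ?_)
  · intro v hv s₁ hF₁ hv₁
    have h₁ := h.frame hF₁ (by decide)
    iterate 2 refine within_seq (within_instr _ le_rfl ?_)
    refine within_seq ((within_forLoop (fun s => s.reg 9) (fun a x => x + I.bit v a)
      (N := I.m) (by simp [Instr.apply, h₁.m]) le_rfl (by simpa using hm) (by decide) (by decide)
      (by decide) (by rintro s r x (rfl | rfl) <;> simp) ?_).imp fun s₂ hF₂ hs₂ => ?_)
    · intro a ha s₂ hF₂ ha₂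
      have h₂ : I.Ready s₂ :=
        ((h₁.apply _ (by decide)).apply _ (by decide)).frame hF₂ (by decide)
      have hv₂ : s₂.reg 13 = v := by
        rw [hF₂.reg 13 (by decide)]; simpa [Instr.apply] using hv₁
      refine within_seq (within_readEntry h₂ hv₂ ha₂ hv.le (by decide) le_rfl
        (within_instr _ le_rfl ?_))
      simp [Instr.apply]
    · rw [iterDown_add] at hs₂
      refine within_seq (within_instr _ le_rfl (within_instr _ le_rfl ?_))
      have h6 : s₂.reg 6 = I.R := by
        rw [hF₂.reg 6 (by decide)]; simpa [Instr.apply] using h₁.R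
      have h13 : s₂.reg 13 = v := by
        rw [hF₂.reg 13 (by decide)]; simpa [Instr.apply] using hv₁
      have h2 : s₂.arr 2 = s₁.arr 2 := by
        rw [hF₂.arr 2 (by decide)]; simp [Instr.apply]
      have h9 : s₂.reg 9 = I.k + ∑ a ∈ Finset.range I.m, I.bit v a := by
        rw [hs₂]; simp [Instr.apply, h₁.k]
      simp [Instr.apply, h6, h13, h2, h9]
  · rw [iterDown_update fun v _ => I.k + ∑ a ∈ Finset.range I.m, I.bit v a - I.R] at hs₁
    have h₁ := h.frame hF₁ (by decide)
    refine within_seq ((within_forLoop (fun s => s.arr 3)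
      (fun a e => Function.update e a (I.bit I.n a))
      h₁.m le_rfl (by simpa using hm) (by decide) (by decide) (by decide) (by simp) ?_).imp
      fun s₂ hF₂ hs₂ => ?_)
    · intro a ha s₂ hF₂ ha₂
      have h₂ := h₁.frame hF₂ (by decide)
      refine within_seq (within_readEntry h₂ h₂.n ha₂ le_rfl (by decide) le_rfl
        (within_instr _ le_rfl ?_))
      simp [Instr.apply, ha₂]
    · rw [iterDown_update fun a _ => I.bit I.n a] at hs₂
      refine within_instr _ le_rfl ?_
      simp [Instr.apply, config, start, hs₂, hF₂.arr 2 (by decide), hs₁, hF₁.arr 3 (by decide)]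

theorem within_decodeProg (hm : I.m ≤ B) (hn : I.n ≤ B) (h : I.Ready s) {T c : ℕ}
    (hT : s.reg 7 = T) (hc : s.reg 8 = c) :
    Within 1 B decodeProg
      (fun s' => config s' = (iterDown (I.decodeStep T) I.m (c, config s)).2) s := by
  iterate 2 refine within_seq (within_instr _ le_rfl ?_)
  set s₀ := (Instr.add 9 8 2).apply ((Instr.const 2 0).apply s) with hs₀
  have h₀ : I.Ready s₀ := (h.apply _ (by decide)).apply _ (by decide)
  have h7 : s₀.reg 7 = T := by simp [hs₀, Instr.apply, hT]
  refine (within_forLoop (fun s => (s.reg 9, config s)) (I.decodeStep T) h₀.m le_rfl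
    (by simpa using hm) (by decide) (by decide) (by decide)
    (by rintro s r x (rfl | rfl) <;> simp [config]) ?_).imp
    fun s' hF hs' => ?_
  · intro a ha s₁ hF₁ ha₁
    have h₁ := h₀.frame hF₁ (by decide)
    have h7₁ : s₁.reg 7 = T := (hF₁.reg 7 (by decide)).trans h7
    refine within_seq (within_readEntry h₁ h₁.n ha₁ le_rfl (by decide) le_rfl ?_)
    refine within_cond le_rfl (fun hb => ?_) fun hb => within_skip le_rfl ?_
    · iterate 2 refine within_seq (within_instr _ le_rfl ?_)
      simp only [Function.update_self] at hb
      refine within_cond le_rfl (fun hT => within_skip le_rfl ?_) fun hT => within_seq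
        (within_instr _ le_rfl ?_)
      · simp [Instr.apply, h7₁] at hT
        simp [Instr.apply, decodeStep, hb, config, show ¬ T ≤ s₁.reg 9 + s₁.reg 9 by omega]
      · simp [Instr.apply, h7₁] at hT
        refine (within_chooseProg (I := I) (p := a) hn ?_ ?_).imp fun s₂ hF₂ hs₂ => ?_
        · exact (((h₁.apply (.const 1 _) ⟨⟨rfl, rfl, rfl, rfl⟩, rfl, rfl⟩).apply _
            (by decide)).apply _ (by decide)).apply _ (by decide)
        · simp [Instr.apply, ha₁]
        · rw [hs₂, hF₂.reg 9 (by decide)]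
          simp [Instr.apply, decodeStep, hb, config, h7₁,
            show T ≤ s₁.reg 9 + s₁.reg 9 by omega]
    · simp only [Function.update_self] at hb
      simp [decodeStep, hb, config]
  · have : config s' = (s'.reg 9, config s').2 := rfl
    rw [this, hs']
    simp [hs₀, Instr.apply, config, hc]

theorem holds_dominantFormula (h : I.Ready s) {p : ℕ} (hp : s.reg 12 = p) :
    dominantFormula.Holds s ↔ I.Dominant p (config s) := by
  simp only [dominantFormula, Formula.Holds, Dominant, config, hp, h.m, h.n,
    Function.update_self, ne_eq, Nat.reduceEqDiff, not_false_eq_true,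
    Function.update_of_ne, not_not]
  refine and_congr_right fun _ => exists_congr fun v => and_congr_right fun hv =>
    and_congr_right fun _ => ?_
  rw [h.entry v hv.le]
  refine and_congr_right fun _ => ?_
  push Not
  refine forall_congr' fun q => forall_congr' fun hq => forall_congr' fun hq' => ?_
  rw [h.entry v hv.le]
  refine forall_congr' fun hq' => forall_congr' fun u => forall_congr' fun hu =>
    forall_congr' fun _ => ?_
  rw [h.entry u hu.le, h.entry u hu.le]

theorem dominantFormula_wellFormed : dominantFormula.WellFormed := by decide

theorem within_greedyProg (hm : I.m ≤ B) (hn : I.n ≤ B) (h : I.Ready s) :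
    Within 1 B greedyProg (fun s' => config s' = I.greedy (config s)) s := by
  refine within_forLoop config _ h.m le_rfl (by simpa using hm) (by decide) (by decide)
    (by decide) (by rintro s r x (rfl | rfl) <;> simp [config]) fun _ _ s₁ hF₁ _ => ?_
  have h₁ := h.frame hF₁ (by decide)
  refine within_forLoop config _ h₁.m le_rfl (by simpa using hm) (by decide) (by decide)
    (by decide) (by rintro s r x (rfl | rfl) <;> simp [config]) fun p hp s₂ hF₂ hp₂ => ?_
  have h₂ := h₁.frame hF₂ (by decide)
  refine within_seq ((Formula.within_eval dominantFormula_wellFormed ?_).imp fun s₃ hF₃ hs₃ => ?_)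
  · intro r hr
    have : r = 4 ∨ r = 3 ∨ r = 4 := by simpa [dominantFormula, Formula.bounds] using hr
    rcases this with rfl | rfl | rfl
    exacts [h₂.n.trans_le hn, h₂.m.trans_le hm, h₂.n.trans_le hn]
  · rw [holds_dominantFormula h₂ hp₂] at hs₃
    have h₃ := h₂.frame hF₃ (by decide)
    have hc : config s₃ = config s₂ := by
      simp only [config, hF₃.arr 2 (by decide), hF₃.arr 3 (by decide), hF₃.reg 10 (by decide)]
    refine within_cond le_rfl (fun hd => ?_) fun hd => within_skip le_rfl ?_
    · refine (within_chooseProg hn h₃ ((hF₃.reg 12 (by decide)).trans hp₂)).imp fun s₄ _ hs₄ => ?_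
      rw [hs₄, hc, greedyStep, if_pos (hs₃.1 hd)]
    · rw [greedyStep, if_neg fun h => hs₃.2 h hd, ← hc]
      simp [config]

open Classical in
theorem within_checkProg (hn : I.n ≤ B) (h : I.Ready s) :
    Within 1 B checkProg
      (fun s' => s'.reg 0 = if I.Success (config s) then 1 else s.reg 0) s := by
  refine within_seq ((Formula.within_eval ?_ ?_).imp fun s₁ hF₁ hs₁ => ?_)
  · decide
  · intro r hr
    obtain rfl : r = 4 := by simpa [Formula.bounds] using hr
    exact h.n.trans_le hn
  · simp only [Formula.Holds, Function.update_self, h.n] at hs₁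
    have h0 : s₁.reg 0 = s.reg 0 := hF₁.reg 0 (by decide)
    have h10 : s₁.reg 10 = s.reg 10 := hF₁.reg 10 (by decide)
    have h5 : s₁.reg 5 = I.k := (hF₁.reg 5 (by decide)).trans h.k
    refine within_cond le_rfl (fun hne => within_skip le_rfl ?_) fun he =>
      within_seq (within_instr _ le_rfl ?_)
    · obtain ⟨v, hv, hnv⟩ := hs₁.1 hne
      rw [if_neg fun hS => hnv (hS.2 v hv)]
      simp [h0]
    · have hall : ∀ v < I.n, s.arr 2 v = 0 := by
        by_contra! hv
        exact hs₁.2 hv he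
      refine within_cond le_rfl (fun hk => within_skip le_rfl ?_) fun hk => within_instr _ le_rfl ?_
      · simp [Instr.apply, h10, h5] at hk
        rw [if_neg fun hS => absurd hS.1 (by simp only [config]; omega)]
        simp [Instr.apply, h0]
      · simp [Instr.apply, h10, h5] at hk
        rw [if_pos ⟨by simp only [config]; omega, hall⟩]
        simp [Instr.apply]

open Classical in
theorem within_trialProg (hI : I.profile.HasDominant I.deleted) (hm : I.m ≤ B) (hn : I.n ≤ B)
    (h : I.Ready s) (hT : s.reg 7 = 2 ^ I.deleted.card) {c : ℕ} (hc : s.reg 8 = c) :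
    Within 1 B trialProg
      (fun s' => s'.reg 0 = if I.Extends (I.decodeSet c) then 1 else s.reg 0) s := by
  refine within_seq ((within_startProg hm hn h).imp fun s₁ hF₁ hs₁ => ?_)
  have h₁ := h.frame hF₁ (by decide)
  refine within_seq ((within_decodeProg hm hn h₁ ((hF₁.reg 7 (by decide)).trans hT)
    ((hF₁.reg 8 (by decide)).trans hc)).imp fun s₂ hF₂ hs₂ => ?_)
  have h₂ := h₁.frame hF₂ (by decide)
  refine within_seq ((within_greedyProg hm hn h₂).imp fun s₃ hF₃ hs₃ => ?_)
  have h₃ := h₂.frame hF₃ (by decide)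
  refine (within_checkProg hn h₃).imp fun s₄ _ hs₄ => ?_
  have hrep : I.Represents (I.decodeSet c) (config s₂) := by
    rw [hs₂, hs₁]
    exact represents_iterDown le_rfl c (I.represents_start _) (by simp)
  have hiff : I.Success (config s₃) ↔ I.Extends (I.decodeSet c) := by
    rw [hs₃, success_greedy_iff hI fun a ha => by simp [hrep.used, ha], hrep.completable_iff]
  rw [hs₄, hF₃.reg 0 (by decide), hF₂.reg 0 (by decide), hF₁.reg 0 (by decide)]
  simp only [hiff]

theorem within_readProg (I : MAVInstance) :
    Within 1 B readProg (fun s => s.reg 3 = I.m ∧ s.reg 4 = I.n ∧ s.reg 5 = I.k ∧ s.reg 6 = I.R)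
      (initial I.encode) := by
  iterate 3 refine within_seq (within_seq (within_instr _ le_rfl (within_instr _ le_rfl ?_)))
  refine within_seq (within_instr _ le_rfl (within_instr _ le_rfl ?_))
  simp [Instr.apply, initial, encode]

theorem within_rowsProg (hn : I.n + 1 ≤ B) (h3 : s.reg 3 = I.m) (h4 : s.reg 4 = I.n)
    (h5 : s.reg 5 = I.k) (h6 : s.reg 6 = I.R) (h0 : s.arr 0 = (initial I.encode).arr 0) :
    Within 1 B rowsProg (fun s' => I.Ready s') s := by
  have hw : Within 1 B rowsProg (fun s' => ∀ v < I.n + 1, s'.arr 1 v = 4 + v * I.m) s := by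
    iterate 4 refine within_seq (within_instr _ le_rfl ?_)
    refine (within_forLoop_of_invariant (N := I.n + 1) (fun j s' => ∃ i, i + j = I.n + 1 ∧
      s'.reg 10 = i ∧ s'.reg 9 = 4 + i * I.m ∧ ∀ v < i, s'.arr 1 v = 4 + v * I.m)
      (by simp [Instr.apply, h4]) le_rfl (by simpa using hn) (by decide) (by decide) (by decide)
      ?_ ?_ ?_).imp fun s' _ hs' => ?_
    · rintro j s r x (rfl | rfl) h <;> simpa using h
    · exact ⟨0, by simp [Instr.apply]⟩
    · rintro j - s₁ hF₁ - ⟨i, hij, h10, h9, harr⟩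
      have h3' : s₁.reg 3 = I.m := by
        rw [hF₁.reg 3 (by decide)]; simpa [Instr.apply] using h3
      iterate 3 refine within_seq (within_instr _ le_rfl ?_)
      refine within_instr _ le_rfl ⟨i + 1, by omega, ?_, ?_, fun v hv => ?_⟩
      · simp [Instr.apply, h10]
      · simp [Instr.apply, h9, h3']; ring
      · rcases Nat.lt_succ_iff_lt_or_eq.1 hv with hv | rfl
        · simp [Instr.apply, h10, hv.ne, harr v hv]
        · simp [Instr.apply, h10, h9]
    · obtain ⟨i, hi, -, -, harr⟩ := hs'
      obtain rfl : i = I.n + 1 := by omega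
      exact harr
  refine hw.imp fun s' hF hs' => ⟨(hF.reg 3 (by decide)).trans h3, (hF.reg 4 (by decide)).trans h4,
    (hF.reg 5 (by decide)).trans h5, (hF.reg 6 (by decide)).trans h6, fun v hv a => ?_⟩
  rw [hs' v (by omega), hF.arr 0 (by decide), h0]
  simp [initial, bit]

theorem iterDown_double (N : ℕ) (hN : N ≤ I.m) (x : ℕ) :
    iterDown (fun a x => if I.bit I.n a = 0 then x else x + x) N x
      = x * 2 ^ ∑ a ∈ Finset.range N, I.bit I.n a := by
  induction N generalizing x with
  | zero => simp [iterDown]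
  | succ N ih =>
    have hbit : I.bit I.n N = _ := I.bit_deleted ⟨N, hN⟩
    rw [iterDown, ih (by omega), Finset.sum_range_succ, hbit]
    split_ifs <;> first | contradiction | (rw [pow_succ]; ring) | simp

theorem within_powProg (hm : I.m ≤ B) (h : I.Ready s) :
    Within 1 B powProg (fun s' => s'.reg 7 = 2 ^ I.deleted.card) s := by
  refine within_seq (within_instr _ le_rfl ?_)
  have h₀ : I.Ready ((Instr.const 7 1).apply s) := h.apply _ (by decide)
  refine (within_forLoop (fun s => s.reg 7) (fun a x => if I.bit I.n a = 0 then x else x + x)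
    h₀.m le_rfl (by simpa using hm) (by decide) (by decide) (by decide)
    (by rintro s r x (rfl | rfl) <;> simp) ?_).imp fun s₁ hF₁ hs₁ => ?_
  · intro a ha s₁ hF₁ ha₁
    have h₁ := h₀.frame hF₁ (by decide)
    refine within_seq (within_readEntry h₁ h₁.n ha₁ le_rfl (by decide) le_rfl ?_)
    refine within_cond le_rfl (fun hb => within_instr _ le_rfl ?_) fun hb =>
      within_skip le_rfl ?_
    · simp only [Function.update_self] at hb
      simp [Instr.apply, hb]
    · simp only [Function.update_self] at hb
      simp [hb]
  · have : ∑ a ∈ Finset.range I.m, I.bit I.n a = I.deleted.card := by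
      rw [Finset.sum_range fun a => I.bit I.n a]
      simp [bit_deleted]
    rw [hs₁, iterDown_double _ le_rfl, this]
    simp [Instr.apply]

theorem isYes_iff_of_m_eq_zero (hm : I.m = 0) : I.IsYes ↔ I.k = 0 := by
  rw [isYes_iff, show I.k ≤ I.m ↔ I.k = 0 by omega]
  refine and_iff_left_of_imp fun hk => ⟨∅, by simp, ∅, by simp, by simp, fun v => ?_⟩
  have : (I.profile v).card ≤ I.m := by simpa using Finset.card_le_univ (I.profile v)
  omega

/-- All loops but the outermost one have at most `B` rounds; the outermost one has `2 ^ t` rounds.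
Without alternatives, no loop is executed. -/
theorem within_mavProg (I : MAVInstance) (hI : I.profile.HasDominant I.deleted)
    (hm : I.m ≤ B) (hn : I.m ≠ 0 → I.n + 1 ≤ B) :
    Within (2 ^ I.deleted.card) B mavProg (fun s => s.reg 0 = 1 ↔ I.IsYes)
      (initial I.encode) := by
  classical
  have hF : 1 ≤ 2 ^ I.deleted.card := Nat.one_le_two_pow
  refine within_seq (((within_readProg I).mono_factor hF).imp fun s hF₀ hs => ?_)
  obtain ⟨h3, h4, h5, h6⟩ := hs
  have h0 : s.reg 0 = 0 := hF₀.reg 0 (by decide)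
  refine within_cond hF (fun hne => within_seq (within_instr _ hF (within_cond hF
    (fun hk => within_skip hF ?_) fun hk => ?_))) fun he => within_seq (within_instr _ hF
    (within_instr _ hF ?_))
  · simp [Instr.apply, h3, h5] at hk
    have : ¬ I.IsYes := fun h => absurd (I.isYes_iff.1 h).1 (by omega)
    simp [Instr.apply, h0, this]
  · simp [Instr.apply, h3, h5] at hk
    rw [h3] at hne
    have hn' := hn hne
    refine within_seq (((within_rowsProg (I := I) hn' ?_ ?_ ?_ ?_ ?_).mono_factor hF).imp
      fun s₁ hF₁ h₁ => ?_)
    · simpa [Instr.apply] using h3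
    · simpa [Instr.apply] using h4
    · simpa [Instr.apply] using h5
    · simpa [Instr.apply] using h6
    · simpa [Instr.apply] using hF₀.arr 0 (by decide)
    refine within_seq (((within_powProg hm h₁).mono_factor hF).imp fun s₂ hF₂ h7 => ?_)
    have h₂ := h₁.frame hF₂ (by decide)
    have h0' : s₂.reg 0 = 0 := by
      rw [hF₂.reg 0 (by decide), hF₁.reg 0 (by decide)]
      simpa [Instr.apply] using h0
    refine (within_forLoop_of_invariant (N := 2 ^ I.deleted.card) (fun j s' => s'.reg 0 =
      if ∃ c, j ≤ c ∧ c < 2 ^ I.deleted.card ∧ I.Extends (I.decodeSet c) then 1 else 0)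
      h7 hF (Nat.le_mul_of_pos_right _ (by omega)) (by decide) (by decide) (by decide)
      ?_ ?_ ?_).imp fun s₃ _ hs₃ => ?_
    · rintro j s r x (rfl | rfl) h <;> simpa using h
    · rw [h0', if_neg]
      rintro ⟨c, h, h', -⟩
      omega
    · intro c hc s₃ hF₃ hc₃ hs₃
      have h₃ := h₂.frame hF₃ (by decide)
      refine (within_trialProg hI hm (by omega) h₃ ((hF₃.reg 7 (by decide)).trans h7) hc₃).imp
        fun s₄ _ hs₄ => ?_
      rw [hs₄, hs₃]
      by_cases hE : I.Extends (I.decodeSet c)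
      · rw [if_pos hE, if_pos ⟨c, le_rfl, hc, hE⟩]
      · rw [if_neg hE]
        refine if_congr ⟨?_, ?_⟩ rfl rfl
        · rintro ⟨c', h, h', h''⟩
          exact ⟨c', by omega, h', h''⟩
        · rintro ⟨c', h, h', h''⟩
          refine ⟨c', h.lt_of_ne ?_, h', h''⟩
          rintro rfl
          exact hE h''
    · rw [hs₃, isYes_iff_exists_lt]
      simp [show I.k ≤ I.m by omega]
  · rw [h3] at he
    rw [isYes_iff_of_m_eq_zero he]
    simp [Instr.apply, h5]
    omega

end MAVInstance

/-! ### Running time -/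

open RAM in
theorem fptInTime_of_hasDominant {promise : MAVInstance → Prop}
    (h : ∀ I, promise I → I.profile.HasDominant I.deleted) :
    FPTInTime (fun t => 2 ^ t) MAVInstance.encode promise MAVInstance.IsYes
      (fun I => I.deleted.card) := by
  refine ⟨MAVInstance.mavProg, 2 * MAVInstance.mavProg.size, fun I hI => ?_⟩
  have hL := I.le_inputLength
  set L := inputLength I.encode
  have hL4 : 4 ≤ L := by omega
  obtain ⟨s, t, he, ht, hs⟩ := I.within_mavProg (B := L) (h I hI) (by omega) fun hm => by
    have : I.n ≤ I.n * I.m := Nat.le_mul_of_pos_right _ (Nat.pos_of_ne_zero hm)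
    omega
  refine ⟨s, t, he, ht.trans (Nat.mul_le_mul_left _ ((Program.cost_le _ _).trans ?_)), hs⟩
  rw [pow_mul]
  -- the exponent 2 absorbs the summand in `L + 2`
  exact Nat.pow_le_pow_left (by nlinarith) _

theorem mainTheorem2 :
    FPTInTime (fun t => 2 ^ t) MAVInstance.encode
      (fun I => (I.profile.deleteAlternatives I.deleted).SinglePeaked)
      MAVInstance.IsYes (fun I => I.deleted.card) ∧
    FPTInTime (fun t => 2 ^ t) MAVInstance.encode
      (fun I => (I.profile.deleteAlternatives I.deleted).SingleCrossing)
      MAVInstance.IsYes (fun I => I.deleted.card) := by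
  exact ⟨fptInTime_of_hasDominant fun _ h => h.hasDominant,
    fptInTime_of_hasDominant fun _ h => h.hasDominant⟩
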